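/- Let $X$ be a complex manifold (for instance the analytic manifold of a smooth complex projective variety), let $f:X\to\mathbb P^1$ be a holomorphic map, and let $D\subset X$ be a divisor with normal crossings such that $f$ takes values in $\mathbb C$ on $U=X\setminus D$. Let $P=f^{-1}(\infty)=\sum_i e_iP_i$ be the pole divisor of $f$, whose support is contained in $D$. For $\mu\in\mathbb R$ put $[\mu P]=\sum_i[\mu e_i]P_i$, where $[\cdot]$ is the integral part, and $\Omega^k_X(\log D)([\mu P])=\mathcal O_X([\mu P])\otimes\Omega^k_X(\log D)$; let $\Omega^k_X(\log D)([\mu P])_+$ be this sheaf if $\mu\ge 0$, and $0$ if $\mu<0$. Let $\nabla=d+df$ and $$\Omega^k_f([\mu P])=\ker\Big(\Omega^k_X(\log D)([\mu P])\xrightarrow{\,df\wedge\,}\Omega^{k+1}_X(\log D)([(\mu+1)P])\big/\Omega^{k+1}_X(\log D)([\mu P])\Big).$$ Consider the following graded sheaves, all contained in $j_*\Omega^\bullet_U$ with $j:U\hookrightarrow X$ the inclusion: - $\Omega_f^\bullet(\mu)$, with $\Omega^k_f([\mu P])$ in degree $k$, and its stupid filtration $\sigma^p$ (keep the degrees $k\ge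 p$), $p\in\mathbb Z$; - for $\lambda\in\mathbb R$, $F^0(\lambda)$, with $\Omega^k_X(\log D)([(k-\lambda)P])$ in degree $k$; - on $F^0(-\mu)$, the filtration $\tau^p$ equal to $F^0(-\mu)$ for $p\le 0$ and, for $p\ge 0$, with $\Omega^k_X(\log D)([(k-p+\mu)P])$ in degree $k\ge p$ and $0$ in degree $k<p$; - for $\lambda\in\mathbb R$, $F^\lambda(\nabla)$, with $\Omega^k_X(\log D)([(k-\lambda)P])_+$ in degree $k$; - for $\alpha\in[0,1)$ and $p\in\mathbb Z$, Yu's irregular Hodge filtration $F^{\mathrm{Yu},p}_\alpha=F^{-\alpha+p}(\nabla)$ and, on $F^0(\nabla)$, the filtration $F^p_\alpha$ equal to $F^0(\nabla)$ for $p\le 0$ and to $F^{-\alpha+p}(\nabla)$ for $p\ge 1$. An inclusion of $\mathbb Z$-filtered complexes of sheaves of $\mathbb C$-vector spaces is called a filtered quasi-isomorphism if for every $p$ it induces a quasi-isomorphism (that is, isomorphisms on the cohomology of all stalks) both between the $p$-th steps of the filtrations and between the $p$-th graded pieces. Then: 1. For every $\mu\in\mathbb R$, $\sigma^p$ and $\tau^p$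 are decreasing filtrations by subcomplexes for $\nabla$, and the natural inclusion $(\Omega_f^\bullet(\mu),\nabla,\sigma^p)\to(F^0(-\mu),\nabla,\tau^p)$ is a filtered quasi-isomorphism. The same holds when $\nabla$ is replaced by $df\wedge$ in both complexes. 2. For every $\alpha\in[0,1)$, the natural inclusions $$(\Omega_f^\bullet(\alpha),\nabla,\sigma^p)\to(F^0(\nabla),F^p_\alpha)\to F^{\mathrm{Yu},p}_\alpha(\Omega^\bullet_X(*D),\nabla)\qquad(p\in\mathbb Z)$$ are filtered quasi-isomorphisms of filtered complexes for $\nabla$. Here $\Omega_X^\bullet(*D)$ (forms with arbitrary poles along $D$) is stable by $\nabla$ and contains every $F^{\mathrm{Yu},p}_\alpha$. -/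

import Mathlib

open CategoryTheory CategoryTheory.Limits Filter Topology
open scoped Manifold ContDiff

namespace KontsevichYu

noncomputable section

/-! ### Filtered complexes and filtered quasi-isomorphisms -/

section FilteredComplexes

variable {M : ℕ → Type} [∀ k, AddCommGroup (M k)] [∀ k, Module ℂ (M k)]
  (δ : ∀ k, M k →ₗ[ℂ] M (k + 1)) (hδ : ∀ k (x : M k), δ (k + 1) (δ k x) = 0)

/-- A graded subspace of the complex `(M, δ)` which is stable by the differential. -/
def IsSubcomplex (A : ∀ k, Submodule ℂ (M k)) : Prop :=
  ∀ k, ∀ x ∈ A k, δ k x ∈ A (k + 1)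

/-- A subcomplex of `(M, δ)`, as a cochain complex of complex vector spaces. -/
def subcomplex (A : ∀ k, Submodule ℂ (M k)) (hA : IsSubcomplex δ A) :
    CochainComplex (ModuleCat.{0} ℂ) ℕ :=
  CochainComplex.of (fun k => ModuleCat.of ℂ (A k))
    (fun k => ModuleCat.ofHom ((δ k).restrict (hA k)))
    (fun k => by
      ext x
      exact congrArg (Subtype.val) (Subtype.ext (hδ k x.1) : (⟨δ (k + 1) (δ k x.1), _⟩ : A (k + 1 + 1)) = 0))

/-- The inclusion between two nested subcomplexes of `(M, δ)`. -/
def inclusion {A B : ∀ k, Submodule ℂ (M k)} (hA : IsSubcomplex δ A) (hB : IsSubcomplex δ B)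
    (hAB : ∀ k, A k ≤ B k) : subcomplex δ hδ A hA ⟶ subcomplex δ hδ B hB :=
  CochainComplex.ofHom (fun k => ModuleCat.ofHom (Submodule.inclusion (hAB k)))
    (fun k => by
      simp only [subcomplex, CochainComplex.of_d]
      rfl)

/-- A decreasing filtration, indexed by `ℤ`, by subcomplexes of `(M, δ)`. -/
structure IsFiltration (A : ℤ → ∀ k, Submodule ℂ (M k)) : Prop where
  isSubcomplex : ∀ p, IsSubcomplex δ (A p)
  antitone : ∀ p q, p ≤ q → ∀ k, A q k ≤ A p k

variable {A B : ℤ → ∀ k, Submodule ℂ (M k)}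

/-- The inclusion of the step `p + 1` of a decreasing filtration in the step `p`. -/
def stepInclusion (hA : IsFiltration δ A) (p : ℤ) :
    subcomplex δ hδ (A (p + 1)) (hA.isSubcomplex (p + 1)) ⟶
      subcomplex δ hδ (A p) (hA.isSubcomplex p) :=
  inclusion δ hδ _ _ (hA.antitone p (p + 1) (by lia))

/-- The graded piece `gr^p = A^p / A^{p+1}` of a filtration by subcomplexes. -/
def gr (hA : IsFiltration δ A) (p : ℤ) : CochainComplex (ModuleCat.{0} ℂ) ℕ :=
  cokernel (stepInclusion δ hδ hA p)

/-- The morphism induced on the graded pieces by an inclusion of filtered complexes. -/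
def grMap (hA : IsFiltration δ A) (hB : IsFiltration δ B) (hAB : ∀ p k, A p k ≤ B p k) (p : ℤ) :
    gr δ hδ hA p ⟶ gr δ hδ hB p :=
  cokernel.map (stepInclusion δ hδ hA p) (stepInclusion δ hδ hB p)
    (inclusion δ hδ (hA.isSubcomplex (p + 1)) (hB.isSubcomplex (p + 1)) (hAB (p + 1)))
    (inclusion δ hδ (hA.isSubcomplex p) (hB.isSubcomplex p) (hAB p))
    rfl

variable (A B) in
/-- `A^p ⊆ B^p` (`p ∈ ℤ`) are decreasing filtrations by subcomplexes of `(M, δ)`, and the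
inclusion is a filtered quasi-isomorphism: it induces quasi-isomorphisms `A^p → B^p` and
`gr_A^p → gr_B^p` for every `p`. -/
def IsFilteredQuasiIso : Prop :=
  ∃ (hA : IsFiltration δ A) (hB : IsFiltration δ B) (hAB : ∀ p k, A p k ≤ B p k),
    ∀ p : ℤ,
      QuasiIso (inclusion δ hδ (hA.isSubcomplex p) (hB.isSubcomplex p) (hAB p)) ∧
      QuasiIso (grMap δ hδ hA hB hAB p)

end FilteredComplexes

/-! ### Exterior product by a `1`-form -/

section Wedge

variable {E : Type*} [NormedAddCommGroup E] [NormedSpace ℂ E] {k : ℕ}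

/-- The exterior product `a ∧ w` of a `1`-form and a `k`-form, normalised as in `extDeriv`:
`(a ∧ w)(v_0, …, v_k) = ∑ (-1)^i a(v_i) w(v_0, …, v_i omitted, …, v_k)`. -/
def wedge (a : E →L[ℂ] ℂ) (w : E [⋀^Fin k]→L[ℂ] ℂ) : E [⋀^Fin (k + 1)]→L[ℂ] ℂ :=
  ContinuousAlternatingMap.alternatizeUncurryFin (a.smulRight w)

theorem wedge_eq (a : E →L[ℂ] ℂ) (w : E [⋀^Fin k]→L[ℂ] ℂ) :
    wedge a w = ContinuousAlternatingMap.alternatizeUncurryFinCLM ℂ E ℂ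
      (ContinuousLinearMap.smulRightL ℂ E (E [⋀^Fin k]→L[ℂ] ℂ) a w) := rfl

theorem wedge_wedge (a : E →L[ℂ] ℂ) (w : E [⋀^Fin k]→L[ℂ] ℂ) :
    wedge a (wedge a w) = 0 := by
  rw [← ContinuousAlternatingMap.alternatizeUncurryFin_alternatizeUncurryFinCLM_comp_of_symmetric
    (f := a.smulRight (a.smulRight w)) (fun x y => by
      simp only [ContinuousLinearMap.smulRight_apply, smul_apply]
      rw [smul_comm])]
  simp only [wedge]
  congr 1
  ext v : 1
  simp

theorem hasFDerivAt_smulRight {G : Type*} [NormedAddCommGroup G] [NormedSpace ℂ G]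
    {a : E → E →L[ℂ] ℂ} {η : E → G} {a' : E →L[ℂ] E →L[ℂ] ℂ} {η' : E →L[ℂ] G} {z : E}
    (ha : HasFDerivAt a a' z) (hη : HasFDerivAt η η' z) :
    ∃ L : E →L[ℂ] E →L[ℂ] G, HasFDerivAt (fun z => (a z).smulRight (η z)) L z ∧
      ∀ x y, L x y = a z y • η' x + a' x y • η z := by
  refine ⟨_, (ContinuousLinearMap.smulRightL ℂ E G).hasFDerivAt_of_bilinear ha hη, ?_⟩
  intro x y
  simp

theorem analyticAt_smulRight {G : Type*} [NormedAddCommGroup G] [NormedSpace ℂ G]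
    {a : E → E →L[ℂ] ℂ} {η : E → G} {z : E}
    (ha : AnalyticAt ℂ a z) (hη : AnalyticAt ℂ η z) :
    AnalyticAt ℂ (fun z => (a z).smulRight (η z)) z :=
  ((ContinuousLinearMap.smulRightL ℂ E G).analyticAt_bilinear (a z, η z)).comp₂ ha hη

theorem analyticAt_alternatize {η : E → E →L[ℂ] E [⋀^Fin k]→L[ℂ] ℂ} {z : E}
    (h : AnalyticAt ℂ η z) :
    AnalyticAt ℂ (fun z => ContinuousAlternatingMap.alternatizeUncurryFin (η z)) z := by
  have g : AnalyticAt ℂ (fun u : E →L[ℂ] E [⋀^Fin k]→L[ℂ] ℂ =>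
      ContinuousAlternatingMap.alternatizeUncurryFin u) (η z) :=
    @ContinuousLinearMap.analyticAt ℂ _ (E →L[ℂ] E [⋀^Fin k]→L[ℂ] ℂ) _ _
      (E [⋀^Fin (k + 1)]→L[ℂ] ℂ) _ _
      (ContinuousAlternatingMap.alternatizeUncurryFinCLM ℂ E ℂ (n := k)) (η z)
  exact g.comp h

theorem analyticAt_extDeriv {η : E → E [⋀^Fin k]→L[ℂ] ℂ} {z : E}
    (h : AnalyticAt ℂ η z) : AnalyticAt ℂ (extDeriv η) z :=
  analyticAt_alternatize h.fderiv

theorem analyticAt_wedge {F : E → ℂ} {η : E → E [⋀^Fin k]→L[ℂ] ℂ}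
    {z : E} (hF : AnalyticAt ℂ F z) (h : AnalyticAt ℂ η z) :
    AnalyticAt ℂ (fun z => wedge (fderiv ℂ F z) (η z)) z :=
  analyticAt_alternatize (analyticAt_smulRight hF.fderiv h)

theorem extDeriv_wedge_add {F : E → ℂ} {η : E → E [⋀^Fin k]→L[ℂ] ℂ}
    {z : E} (hF : AnalyticAt ℂ F z) (hη : AnalyticAt ℂ η z) :
    extDeriv (fun z => wedge (fderiv ℂ F z) (η z)) z
      + wedge (fderiv ℂ F z) (extDeriv η z) = 0 := by
  have h₁ : HasFDerivAt (fderiv ℂ F) (fderiv ℂ (fderiv ℂ F) z) z :=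
    hF.fderiv.differentiableAt.hasFDerivAt
  have h₂ : HasFDerivAt η (fderiv ℂ η z) z := hη.differentiableAt.hasFDerivAt
  obtain ⟨L, hL, hL'⟩ := hasFDerivAt_smulRight h₁ h₂
  have h₄ : fderiv ℂ (fun z => wedge (fderiv ℂ F z) (η z)) z =
      (ContinuousAlternatingMap.alternatizeUncurryFinCLM ℂ E ℂ (n := k)).comp L :=
    ((ContinuousAlternatingMap.alternatizeUncurryFinCLM ℂ E ℂ
      (n := k)).hasFDerivAt.comp z hL).fderiv
  have hs : IsSymmSndFDerivAt ℂ F z := hF.contDiffAt.isSymmSndFDerivAt (n := ω) (by simp)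
  simp only [extDeriv, wedge] at h₄ ⊢
  rw [h₄, ← ContinuousAlternatingMap.alternatizeUncurryFin_add,
    ← ContinuousAlternatingMap.alternatizeUncurryFin_alternatizeUncurryFinCLM_comp_of_symmetric
    (f := L + (fderiv ℂ F z).smulRight (fderiv ℂ η z)) (fun x y => by
      simp [hL', hs.eq x y]
      abel)]
  congr 1
  ext v : 1
  simp

end Wedge

/-! ### Germs of differential forms on the complement of coordinate hyperplanes -/

/-- Constant-coefficient `k`-forms on `ℂⁿ`. -/
abbrev Form (n k : ℕ) : Type := (Fin n → ℂ) [⋀^Fin k]→L[ℂ] ℂ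

variable {n : ℕ}

/-- The complement in `ℂⁿ` of the coordinate hyperplanes `z_i = 0`, `i ∈ S`. -/
def offHyperplanes (S : Finset (Fin n)) : Set (Fin n → ℂ) := {z | ∀ i ∈ S, z i ≠ 0}

/-- The filter of neighbourhoods of the origin in the complement of the coordinate hyperplanes
`z_i = 0`, `i ∈ S`. -/
def nhdsOff (S : Finset (Fin n)) : Filter (Fin n → ℂ) := 𝓝[offHyperplanes S] 0

theorem isOpen_offHyperplanes (S : Finset (Fin n)) : IsOpen (offHyperplanes S) := by
  have : offHyperplanes S = ⋂ i ∈ S, {z : Fin n → ℂ | z i ≠ 0} := by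
    ext z; simp [offHyperplanes]
  rw [this]
  exact isOpen_biInter_finset fun i _ => isOpen_ne_fun (continuous_apply i) continuous_const

theorem eventually_nhdsOff_nhds {S : Finset (Fin n)} {p : (Fin n → ℂ) → Prop}
    (h : ∀ᶠ z in nhdsOff S, p z) : ∀ᶠ z in nhdsOff S, ∀ᶠ w in 𝓝 z, p w := by
  filter_upwards [eventually_eventually_nhdsWithin.2 h, eventually_mem_nhdsWithin] with z hz hzS
  rwa [(isOpen_offHyperplanes S).nhdsWithin_eq hzS] at hz

/-- The exterior derivative on germs at the origin of forms defined off the coordinate hyperplanes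
`z_i = 0`, `i ∈ S`. -/
def dGerm (S : Finset (Fin n)) (k : ℕ) (γ : Germ (nhdsOff S) (Form n k)) :
    Germ (nhdsOff S) (Form n (k + 1)) :=
  Germ.map' extDeriv (fun _ _ h => (eventually_nhdsOff_nhds h).mono fun _ hz =>
    EventuallyEq.extDeriv_eq hz) γ

/-- The left multiplication by `dF` on germs of forms. -/
def dfGerm (S : Finset (Fin n)) (F : (Fin n → ℂ) → ℂ) (k : ℕ)
    (γ : Germ (nhdsOff S) (Form n k)) : Germ (nhdsOff S) (Form n (k + 1)) :=
  Germ.map₂ wedge (↑(fderiv ℂ F) : Germ (nhdsOff S) ((Fin n → ℂ) →L[ℂ] ℂ)) γ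

/-- Germs at the origin of holomorphic `k`-forms defined off the coordinate hyperplanes
`z_i = 0`, `i ∈ S` (with no condition along these hyperplanes). -/
def HolForms (S : Finset (Fin n)) (k : ℕ) : Submodule ℂ (Germ (nhdsOff S) (Form n k)) where
  carrier := {γ | ∃ η : (Fin n → ℂ) → Form n k,
    (η : Germ (nhdsOff S) (Form n k)) = γ ∧ ∀ᶠ z in nhdsOff S, AnalyticAt ℂ η z}
  zero_mem' := ⟨0, rfl, Eventually.of_forall fun _ => analyticAt_const⟩
  add_mem' := by
    rintro _ _ ⟨η, rfl, hη⟩ ⟨θ, rfl, hθ⟩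
    exact ⟨η + θ, rfl, (hη.and hθ).mono fun z h => h.1.add h.2⟩
  smul_mem' := by
    rintro c _ ⟨η, rfl, hη⟩
    exact ⟨c • η, rfl, hη.mono fun z h => h.const_smul⟩

/-- The operator `u d + v dF ∧` on germs of holomorphic forms defined off the coordinate hyperplanes
`z_i = 0`, `i ∈ S`. For `u = v = 1` this is `∇ = d + dF`, and for `u = 0`, `v = 1` it is `dF ∧`. -/
def twistedD (S : Finset (Fin n)) (F : (Fin n → ℂ) → ℂ) (hF : ∀ᶠ z in nhdsOff S, AnalyticAt ℂ F z)
    (u v : ℂ) (k : ℕ) : HolForms S k →ₗ[ℂ] HolForms S (k + 1) where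
  toFun γ := ⟨u • dGerm S k γ.1 + v • dfGerm S F k γ.1, by
    obtain ⟨_, η, rfl, hη⟩ := γ
    exact ⟨u • extDeriv η + v • fun z => wedge (fderiv ℂ F z) (η z), rfl,
      (hη.and hF).mono fun z h =>
        (analyticAt_extDeriv h.1).const_smul.add (analyticAt_wedge h.2 h.1).const_smul⟩⟩
  map_add' := by
    rintro ⟨_, η, rfl, hη⟩ ⟨_, θ, rfl, hθ⟩
    refine Subtype.ext (Germ.coe_eq.2 ?_)
    filter_upwards [hη, hθ] with z h₁ h₂
    change u • extDeriv (η + θ) z + v • wedge (fderiv ℂ F z) (η z + θ z) =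
      (u • extDeriv η z + v • wedge (fderiv ℂ F z) (η z)) +
        (u • extDeriv θ z + v • wedge (fderiv ℂ F z) (θ z))
    rw [extDeriv_add h₁.differentiableAt h₂.differentiableAt]
    simp only [wedge_eq, map_add, smul_add]
    abel
  map_smul' := by
    rintro c ⟨_, η, rfl, hη⟩
    refine Subtype.ext (Germ.coe_eq.2 ?_)
    filter_upwards [hη] with z h₁
    change u • extDeriv (c • η) z + v • wedge (fderiv ℂ F z) (c • η z) =
      c • (u • extDeriv η z + v • wedge (fderiv ℂ F z) (η z))
    rw [extDeriv_smul]
    simp only [wedge_eq, map_smul, smul_add, smul_comm c]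

theorem twistedD_twistedD (S : Finset (Fin n)) (F : (Fin n → ℂ) → ℂ)
    (hF : ∀ᶠ z in nhdsOff S, AnalyticAt ℂ F z) (u v : ℂ) (k : ℕ) (γ : HolForms S k) :
    twistedD S F hF u v (k + 1) (twistedD S F hF u v k γ) = 0 := by
  obtain ⟨_, η, rfl, hη⟩ := γ
  refine Subtype.ext (Germ.coe_eq.2 ?_)
  filter_upwards [hη, hF] with z h₁ h₂
  have hd := (analyticAt_extDeriv h₁).differentiableAt
  have hw := (analyticAt_wedge h₂ h₁).differentiableAt
  have hdd : extDeriv (extDeriv η) z = 0 :=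
    extDeriv_extDeriv_apply (r := ω) h₁.contDiffAt (by simp)
  have hdw := extDeriv_wedge_add h₂ h₁
  change u • extDeriv (u • extDeriv η + v • fun z => wedge (fderiv ℂ F z) (η z)) z +
    v • wedge (fderiv ℂ F z) (u • extDeriv η z + v • wedge (fderiv ℂ F z) (η z)) = 0
  rw [extDeriv_add (hd.const_smul u) (hw.const_smul v), extDeriv_smul, extDeriv_smul, hdd]
  simp only [wedge_eq, map_add, map_smul]
  simp only [← wedge_eq]
  rw [wedge_wedge, eq_neg_of_add_eq_zero_left hdw]
  simp only [smul_zero, zero_add, add_zero, smul_neg, smul_comm v u]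
  exact neg_add_cancel _

/-! ### Logarithmic forms with poles -/

/-- The logarithmic frame of vector fields: `z_i ∂/∂z_i` for `i ∈ S` and `∂/∂z_i` for `i ∉ S`.
It is dual to the coframe `dz_i / z_i` (`i ∈ S`), `dz_i` (`i ∉ S`). -/
def logFrame (S : Finset (Fin n)) (z : Fin n → ℂ) (i : Fin n) : Fin n → ℂ :=
  Pi.single i (if i ∈ S then z i else 1)

/-- The stalk at the origin of `Ω^k(log D)(∑ m_i D_i)`, where `D = ⋃_{i ∈ S} D_i` and
`D_i = {z_i = 0}`: the germs `η` such that `(∏_{i ∈ S} z_i ^ m_i) η` is a combination, with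
coefficients holomorphic at the origin, of exterior products of the `dz_i / z_i` (`i ∈ S`) and the
`dz_i` (`i ∉ S`). These coefficients are the values on the vectors of the dual frame `logFrame`. -/
def logForms (S : Finset (Fin n)) (m : Fin n → ℤ) (k : ℕ) : Submodule ℂ (HolForms S k) where
  carrier := {γ | ∃ η : (Fin n → ℂ) → Form n k, (η : Germ (nhdsOff S) (Form n k)) = γ.1 ∧
    ∀ J : Fin k → Fin n, ∃ c : (Fin n → ℂ) → ℂ, AnalyticAt ℂ c 0 ∧
      ∀ᶠ z in nhdsOff S, (∏ i ∈ S, z i ^ m i) * η z (fun a => logFrame S z (J a)) = c z}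
  zero_mem' := ⟨0, rfl, fun _ => ⟨0, analyticAt_const, Eventually.of_forall fun _ => by simp⟩⟩
  add_mem' := by
    rintro ⟨_, h₁⟩ ⟨_, h₂⟩ ⟨η, rfl, hη⟩ ⟨θ, rfl, hθ⟩
    refine ⟨η + θ, rfl, fun J => ?_⟩
    obtain ⟨a, ha, ha'⟩ := hη J
    obtain ⟨b, hb, hb'⟩ := hθ J
    refine ⟨a + b, ha.add hb, ?_⟩
    filter_upwards [ha', hb'] with z h h'
    simp [← h, ← h', mul_add]
  smul_mem' := by
    rintro t ⟨_, h₁⟩ ⟨η, rfl, hη⟩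
    refine ⟨t • η, rfl, fun J => ?_⟩
    obtain ⟨a, ha, ha'⟩ := hη J
    refine ⟨t • a, ha.const_smul, ?_⟩
    filter_upwards [ha'] with z h
    simp [← h, mul_left_comm]

/-- The stalk at the origin of `Ω^k(*D)`, where `D = ⋃_{i ∈ S} {z_i = 0}`: the germs of forms which
become holomorphic at the origin after multiplication by a power of `∏_{i ∈ S} z_i`. -/
def meroForms (S : Finset (Fin n)) (k : ℕ) : Submodule ℂ (HolForms S k) where
  carrier := {γ | ∃ η : (Fin n → ℂ) → Form n k, (η : Germ (nhdsOff S) (Form n k)) = γ.1 ∧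
    ∃ (N : ℕ) (θ : (Fin n → ℂ) → Form n k), AnalyticAt ℂ θ 0 ∧
      ∀ᶠ z in nhdsOff S, (∏ i ∈ S, z i) ^ N • η z = θ z}
  zero_mem' := ⟨0, rfl, 0, 0, analyticAt_const, Eventually.of_forall fun _ => by simp⟩
  add_mem' := by
    rintro ⟨_, h₁⟩ ⟨_, h₂⟩ ⟨η, rfl, N, a, ha, ha'⟩ ⟨θ, rfl, N', b, hb, hb'⟩
    have hp : ∀ j : ℕ, AnalyticAt ℂ (fun z : Fin n → ℂ => (∏ i ∈ S, z i) ^ j) 0 := fun j =>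
      (Finset.analyticAt_fun_prod S fun i _ =>
        (ContinuousLinearMap.proj (R := ℂ) (φ := fun _ : Fin n => ℂ) i).analyticAt 0).pow j
    refine ⟨η + θ, rfl, N + N', _, ((hp N').smul ha).add ((hp N).smul hb), ?_⟩
    filter_upwards [ha', hb'] with z h h'
    change _ • (η z + θ z) = (∏ i ∈ S, z i) ^ N' • a z + (∏ i ∈ S, z i) ^ N • b z
    rw [← h, ← h', smul_smul, smul_smul, smul_add, pow_add, mul_comm]
  smul_mem' := by
    rintro t ⟨_, h₁⟩ ⟨η, rfl, N, a, ha, ha'⟩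
    refine ⟨t • η, rfl, N, t • a, ha.const_smul, ?_⟩
    filter_upwards [ha'] with z h
    change _ • (t • η z) = t • a z
    rw [← h, smul_comm]

section Filtrations

/-! In this section the pole divisor is `P = ∑ e_i D_i`, with `D_i = {z_i = 0}`. All objects are
stalks at the origin. -/

variable (S : Finset (Fin n)) (e : Fin n → ℕ)

/-- `Ω^k(log D)([μP])`, where `[μP] = ∑ [μ e_i] D_i`. -/
def logP (μ : ℝ) (k : ℕ) : Submodule ℂ (HolForms S k) :=
  logForms S (fun i => ⌊μ * (e i : ℝ)⌋) k

/-- `Ω^k(log D)([μP])_+`, which is `Ω^k(log D)([μP])` if `μ ≥ 0` and zero otherwise. -/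
def logPPlus (μ : ℝ) (k : ℕ) : Submodule ℂ (HolForms S k) :=
  open Classical in if 0 ≤ μ then logP S e μ k else ⊥

variable (F : (Fin n → ℂ) → ℂ) (hF : ∀ᶠ z in nhdsOff S, AnalyticAt ℂ F z)

/-- `Ω_f^k([μP])`, the kernel of
`df : Ω^k(log D)([μP]) → Ω^{k+1}(log D)([(μ+1)P]) / Ω^{k+1}(log D)([μP])`. -/
def kontsevich (μ : ℝ) (k : ℕ) : Submodule ℂ (HolForms S k) :=
  logP S e μ k ⊓ (logP S e μ (k + 1)).comap (twistedD S F hF 0 1 k)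

/-- The stupid filtration `σ^p` of the complex `Ω_f^•(μ)`. -/
def sigma (μ : ℝ) (p : ℤ) (k : ℕ) : Submodule ℂ (HolForms S k) :=
  if p ≤ (k : ℤ) then kontsevich S e F hF μ k else ⊥

/-- The complex `F^0(lam)`, with `Ω^k(log D)([(k - lam)P])` in degree `k`. -/
def F0 (lam : ℝ) (k : ℕ) : Submodule ℂ (HolForms S k) := logP S e ((k : ℝ) - lam) k

/-- The filtration `τ^p` of `F^0(-μ)`: it is `F^0(-μ)` if `p ≤ 0`, and, if `p ≥ 0`, the complex
`Ω^p(log D)([μP]) → Ω^{p+1}(log D)([(1+μ)P]) → ⋯` starting in degree `p`. -/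
def tau (μ : ℝ) (p : ℤ) (k : ℕ) : Submodule ℂ (HolForms S k) :=
  if p ≤ 0 then F0 S e (-μ) k
  else if p ≤ (k : ℤ) then logP S e ((k : ℝ) - (p : ℝ) + μ) k else ⊥

/-- The complex `F^lam(∇)`, with `Ω^k(log D)([(k - lam)P])_+` in degree `k`. -/
def FYu (lam : ℝ) (k : ℕ) : Submodule ℂ (HolForms S k) := logPPlus S e ((k : ℝ) - lam) k

/-- The filtration `F_α^p` of the complex `F^0(∇)`: it is `F^0(∇)` if `p ≤ 0`, and `F^{-α+p}(∇)`
if `p ≥ 1`. -/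
def truncatedFYu (α : ℝ) (p : ℤ) (k : ℕ) : Submodule ℂ (HolForms S k) :=
  if p ≤ 0 then FYu S e 0 k else FYu S e (-α + (p : ℝ)) k

/-- The irregular Hodge filtration `F_α^{Yu,p} = F^{-α+p}(∇)`. -/
def irregularHodge (α : ℝ) (p : ℤ) (k : ℕ) : Submodule ℂ (HolForms S k) :=
  FYu S e (-α + (p : ℝ)) k

end Filtrations

/-! ### The geometric setting

All complexes below are complexes of subsheaves of the sheaves `j_* Ω^k_U` on the complex manifold
`X`, where `j : U = X ∖ D → X` is the inclusion. A morphism of complexes of sheaves is a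
quasi-isomorphism when it is so on all stalks, and the stalks at `x` are computed in a chart centred
at `x` which is adapted to `D`: the stalk of `j_* Ω^k_U` is then `HolForms S k`. -/

section Geometry

variable (n) {X : Type*} [TopologicalSpace X] [ChartedSpace (Fin n → ℂ) X]

/-- The coordinate `t` of the chart `ℂ = ℙ¹ ∖ {∞}` (with the irrelevant value `0` at `∞`). -/
def coordT (p : OnePoint ℂ) : ℂ := p.elim 0 id

/-- The coordinate `t' = 1/t` of the chart `ℙ¹ ∖ {0}`, vanishing at `∞` (with the irrelevant
value `0` at `0`). -/
def coordT' (p : OnePoint ℂ) : ℂ := p.elim 0 fun t => t⁻¹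

/-- Holomorphic maps from the complex manifold `X` to the projective line `ℙ¹ = ℂ ∪ {∞}`. -/
structure IsHolomorphicToP1 (f : X → OnePoint ℂ) : Prop where
  continuous : Continuous f
  contMDiffAt_coordT : ∀ x, f x ≠ OnePoint.infty →
    ContMDiffAt 𝓘(ℂ, Fin n → ℂ) 𝓘(ℂ, ℂ) ω (fun y => coordT (f y)) x
  contMDiffAt_coordT' : ∀ x, f x ≠ ((0 : ℂ) : OnePoint ℂ) →
    ContMDiffAt 𝓘(ℂ, Fin n → ℂ) 𝓘(ℂ, ℂ) ω (fun y => coordT' (f y)) x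

/-- A holomorphic chart of `X` centred at `x` in which `D` is a union of coordinate hyperplanes
`z_i = 0`, `i ∈ S`. -/
structure NCChart (D : Set X) (x : X) where
  chart : OpenPartialHomeomorph X (Fin n → ℂ)
  mem_maximalAtlas : chart ∈ IsManifold.maximalAtlas 𝓘(ℂ, Fin n → ℂ) ω X
  mem_source : x ∈ chart.source
  map_eq_zero : chart x = 0
  S : Finset (Fin n)
  mem_iff : ∀ y ∈ chart.source, y ∈ D ↔ ∃ i ∈ S, chart y i = 0

/-- `D` is (the support of) a reduced divisor with normal crossings. -/
def IsNormalCrossing (D : Set X) : Prop := ∀ x, Nonempty (NCChart n D x)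

variable {n} {D : Set X} {x : X} (c : NCChart n D x) (f : X → OnePoint ℂ)

/-- The function `f`, off `f⁻¹(∞)`, in the coordinates of the chart. -/
def NCChart.localF (z : Fin n → ℂ) : ℂ := coordT (f (c.chart.symm z))

/-- The function `1/f`, off `f⁻¹(0)`, in the coordinates of the chart. -/
def NCChart.localInvF (z : Fin n → ℂ) : ℂ := coordT' (f (c.chart.symm z))

/-- The multiplicity `e_i` of the pole divisor `P = f⁻¹(∞)` along the hyperplane `z_i = 0` near
the centre `x` of the chart: if `f x = ∞`, it is the greatest `m` such that `z_i ^ m` divides the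
holomorphic germ `1/f`; if `f x ≠ ∞`, then `P` is empty near `x` and it is zero. -/
def NCChart.mult (i : Fin n) : ℕ :=
  open Classical in
  if f x = OnePoint.infty then
    sSup {m : ℕ | ∃ g : (Fin n → ℂ) → ℂ, AnalyticAt ℂ g 0 ∧
      ∀ᶠ z in 𝓝 0, c.localInvF f z = z i ^ m * g z}
  else 0

theorem NCChart.analyticAt_localF (hf : IsHolomorphicToP1 n f)
    (hfD : ∀ y, y ∉ D → f y ≠ OnePoint.infty) :
    ∀ᶠ z in nhdsOff c.S, AnalyticAt ℂ (c.localF f) z := by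
  have h0 : (0 : Fin n → ℂ) ∈ c.chart.target := c.map_eq_zero ▸ c.chart.map_source c.mem_source
  filter_upwards [mem_nhdsWithin_of_mem_nhds (c.chart.open_target.mem_nhds h0),
    eventually_mem_nhdsWithin] with z hz hzS
  have hD : c.chart.symm z ∉ D := by
    rw [c.mem_iff _ (c.chart.map_target hz), c.chart.right_inv hz]
    rintro ⟨i, hi, h⟩
    exact hzS i hi h
  have h₁ := hf.contMDiffAt_coordT _ (hfD _ hD)
  have h₂ : ContMDiffAt 𝓘(ℂ, Fin n → ℂ) 𝓘(ℂ, Fin n → ℂ) ω c.chart.symm z :=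
    (contMDiffOn_symm_of_mem_maximalAtlas c.mem_maximalAtlas).contMDiffAt
      (c.chart.open_target.mem_nhds hz)
  exact (h₁.comp z h₂).contDiffAt.analyticAt

/-- The operator `u d + v df ∧` on the stalk at `x` of the sheaf of holomorphic forms on `X ∖ D`,
in the coordinates of the chart. -/
def NCChart.diff (hf : IsHolomorphicToP1 n f) (hfD : ∀ y, y ∉ D → f y ≠ OnePoint.infty)
    (u v : ℂ) (k : ℕ) : HolForms c.S k →ₗ[ℂ] HolForms c.S (k + 1) :=
  twistedD c.S (c.localF f) (c.analyticAt_localF f hf hfD) u v k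

theorem NCChart.diff_diff (hf : IsHolomorphicToP1 n f)
    (hfD : ∀ y, y ∉ D → f y ≠ OnePoint.infty) (u v : ℂ) (k : ℕ) (γ : HolForms c.S k) :
    c.diff f hf hfD u v (k + 1) (c.diff f hf hfD u v k γ) = 0 :=
  twistedD_twistedD _ _ _ u v k γ

/-- `A^p ⊆ B^p` (`p ∈ ℤ`) are filtrations by subcomplexes for the differential `u d + v df ∧`, and
the inclusion is a filtered quasi-isomorphism (on the stalks at `x`). -/
def NCChart.IsFilteredQuasiIso (hf : IsHolomorphicToP1 n f)
    (hfD : ∀ y, y ∉ D → f y ≠ OnePoint.infty) (u v : ℂ)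
    (A B : ℤ → ∀ k, Submodule ℂ (HolForms c.S k)) : Prop :=
  KontsevichYu.IsFilteredQuasiIso (M := fun k => HolForms c.S k)
    (c.diff f hf hfD u v) (c.diff_diff f hf hfD u v) A B

end Geometry

end

end KontsevichYu

/-!
Along a suitable vector field of the logarithmic frame, the derivative of `f` has no zero off `D`
and a pole of order exactly `e_i` along each `P_i`, because `1 / f` is near `P` a unit times the
monomial `∏ z_i ^ e_i`. Contraction with that vector field, divided by this derivative, is a
homotopy from the identity to zero for `df ∧` which lowers the pole order by `P`. Since `d` does
not raise pole orders along logarithmic forms, the same contraction is, up to forms of lower pole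
order, a homotopy for `u d + v df ∧` whenever `v ≠ 0`: pole orders can be reduced by `P` modulo
exact forms as long as the differential allows it, and finitely many reductions compare any two of
the filtrations. Where `f` is finite `P` is empty, and pole orders do not depend on `μ`.
-/

namespace KontsevichYu

noncomputable section

/-! ### A criterion for filtered quasi-isomorphisms -/

section ShortExact

variable {ι : Type*} {c : ComplexShape ι}

theorem quasiIso_f_of_acyclic_X₃ {C : Type*} [Category* C] [Abelian C]
    {S : ShortComplex (HomologicalComplex C c)} (hS : S.ShortExact) (h : S.X₃.Acyclic) :
    QuasiIso S.f := by
  have hzero (i : ι) : IsZero (S.X₃.homology i) := (h i).isZero_homology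
  refine (quasiIso_iff _).2 fun j => (quasiIsoAt_iff_isIso_homologyMap _ j).2 ?_
  have : Epi (HomologicalComplex.homologyMap S.f j) :=
    (hS.homology_exact₂ j).epi_f ((hzero j).eq_of_tgt _ _)
  have : Mono (HomologicalComplex.homologyMap S.f j) := by
    by_cases hj : ∃ i, c.Rel i j
    · obtain ⟨i, hij⟩ := hj
      exact (hS.homology_exact₁ i j hij).mono_g ((hzero i).eq_of_src _ _)
    · have := hS.mono_f
      exact HomologicalComplex.mono_homologyMap_of_mono_of_not_rel S.f j (not_exists.1 hj)
  exact isIso_of_mono_of_epi _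

theorem exactAt_X₃_of_moduleCat {R : Type*} [Ring R]
    {S : ShortComplex (HomologicalComplex (ModuleCat R) c)} (hS : S.ShortExact) {i j k : ι}
    (hi : c.prev j = i) (hk : c.next j = k)
    (h : ∀ (y : S.X₂.X j) (x : S.X₁.X k), S.f.f k x = S.X₂.d j k y →
      ∃ (y' : S.X₂.X i) (x' : S.X₁.X j), S.X₂.d i j y' + S.f.f j x' = y) :
    S.X₃.ExactAt j := by
  rw [HomologicalComplex.exactAt_iff' _ i j k hi hk, ShortComplex.moduleCat_exact_iff]
  intro (z : S.X₃.X j) (hz : S.X₃.d j k z = 0)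
  have := hS.epi_g
  have hexact := (hS.map_of_exact (HomologicalComplex.eval (ModuleCat R) c k)).exact
  obtain ⟨y, rfl⟩ := (ModuleCat.epi_iff_surjective (S.g.f j)).1 inferInstance z
  have hgd : S.g.f k (S.X₂.d j k y) = 0 := by
    rw [← hz]
    exact (ConcreteCategory.congr_hom (S.g.comm j k) y).symm
  obtain ⟨x, hx⟩ := (ShortComplex.moduleCat_exact_iff _).1 hexact _ hgd
  obtain ⟨y', x', rfl⟩ := h y x hx
  have hgf : S.g.f j (S.f.f j x') = 0 :=
    ConcreteCategory.congr_hom (congrArg (fun φ => φ.f j) S.zero) x'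
  refine ⟨S.g.f i y', ?_⟩
  rw [map_add, hgf, add_zero]
  exact ConcreteCategory.congr_hom (S.g.comm i j) y'

end ShortExact

section Subcomplexes

variable {M : ℕ → Type} [∀ k, AddCommGroup (M k)] [∀ k, Module ℂ (M k)]
  (δ : ∀ k, M k →ₗ[ℂ] M (k + 1)) (hδ : ∀ k (x : M k), δ (k + 1) (δ k x) = 0)
  {A B : ∀ k, Submodule ℂ (M k)}

/-- The quotient `B / A` of graded subspaces of the complex `(M, δ)` has no cohomology, in terms of
representatives. -/
structure QuotientExact (A B : ∀ k, Submodule ℂ (M k)) : Prop where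
  mem_zero : ∀ x ∈ B 0, δ 0 x ∈ A 1 → x ∈ A 0
  exists_sub_mem : ∀ k, ∀ x ∈ B (k + 1), δ (k + 1) x ∈ A (k + 2) →
    ∃ y ∈ B k, x - δ k y ∈ A (k + 1)

theorem subcomplex_d_apply (hA : IsSubcomplex δ A) (k : ℕ) (x : A k) :
    (subcomplex δ hδ A hA).d k (k + 1) x = (⟨δ k x, hA k x x.2⟩ : A (k + 1)) := by
  simp only [subcomplex, CochainComplex.of_d]
  rfl

instance mono_inclusion (hA : IsSubcomplex δ A) (hB : IsSubcomplex δ B) (hAB : ∀ k, A k ≤ B k) :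
    Mono (inclusion δ hδ hA hB hAB) := by
  have (k : ℕ) : Mono ((inclusion δ hδ hA hB hAB).f k) :=
    (ModuleCat.mono_iff_injective (ModuleCat.ofHom (Submodule.inclusion (hAB k)))).2
      (Submodule.inclusion_injective (hAB k))
  exact HomologicalComplex.mono_of_mono_f _ this

/-- The short complex `A → B → B / A` of two nested subcomplexes of `(M, δ)`. -/
abbrev inclusionSequence (hA : IsSubcomplex δ A) (hB : IsSubcomplex δ B) (hAB : ∀ k, A k ≤ B k) :
    ShortComplex (CochainComplex (ModuleCat.{0} ℂ) ℕ) :=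
  ShortComplex.mk (inclusion δ hδ hA hB hAB) (cokernel.π _) (cokernel.condition _)

theorem shortExact_inclusionSequence (hA : IsSubcomplex δ A) (hB : IsSubcomplex δ B)
    (hAB : ∀ k, A k ≤ B k) : (inclusionSequence δ hδ hA hB hAB).ShortExact where
  exact := ShortComplex.exact_cokernel _
  mono_f := mono_inclusion ..
  epi_g := inferInstance

variable {δ} in
theorem QuotientExact.quasiIso_inclusion (h : QuotientExact δ A B) (hA : IsSubcomplex δ A)
    (hB : IsSubcomplex δ B) (hAB : ∀ k, A k ≤ B k) : QuasiIso (inclusion δ hδ hA hB hAB) := by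
  have hS := shortExact_inclusionSequence δ hδ hA hB hAB
  refine quasiIso_f_of_acyclic_X₃ hS fun k => ?_
  have hd (k : ℕ) (x : B k) (y : A (k + 1))
      (hy : (inclusion δ hδ hA hB hAB).f (k + 1) y = (subcomplex δ hδ B hB).d k (k + 1) x) :
      δ k x ∈ A (k + 1) := by
    rw [subcomplex_d_apply] at hy
    have hyx : (y : M (k + 1)) = δ k x := congrArg Subtype.val hy
    exact hyx ▸ y.2
  cases k with
  | zero =>
    refine exactAt_X₃_of_moduleCat hS (i := 0) (k := 1) (by simp) (by simp) ?_
    intro (x : B 0) (y : A 1) hy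
    refine ⟨0, (⟨x, h.mem_zero x x.2 (hd 0 x y hy)⟩ : A 0), ?_⟩
    rw [map_zero, zero_add]
    rfl
  | succ k =>
    refine exactAt_X₃_of_moduleCat hS (i := k) (k := k + 2) (by simp) (by simp) ?_
    intro (x : B (k + 1)) (y : A (k + 2)) hy
    obtain ⟨z, hz, hxz⟩ := h.exists_sub_mem k x x.2 (hd (k + 1) x y hy)
    refine ⟨(⟨z, hz⟩ : B k), (⟨x - δ k z, hxz⟩ : A (k + 1)), ?_⟩
    rw [subcomplex_d_apply]
    exact Subtype.ext (add_sub_cancel (δ k z) (x : M (k + 1)))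

theorem isFilteredQuasiIso_of_quotientExact {A B : ℤ → ∀ k, Submodule ℂ (M k)}
    (hA : IsFiltration δ A) (hB : IsFiltration δ B) (hAB : ∀ p k, A p k ≤ B p k)
    (h : ∀ p, QuotientExact δ (A p) (B p)) : IsFilteredQuasiIso δ hδ A B := by
  have hstep (p : ℤ) := (h p).quasiIso_inclusion hδ (hA.isSubcomplex p) (hB.isSubcomplex p) (hAB p)
  refine ⟨hA, hB, hAB, fun p => ⟨hstep p, ?_⟩⟩
  let sequence {A : ℤ → ∀ k, Submodule ℂ (M k)} (hA : IsFiltration δ A) :=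
    inclusionSequence δ hδ (hA.isSubcomplex (p + 1)) (hA.isSubcomplex p)
      (hA.antitone p (p + 1) (by lia))
  let φ : sequence hA ⟶ sequence hB :=
    { τ₁ := inclusion δ hδ (hA.isSubcomplex (p + 1)) (hB.isSubcomplex (p + 1)) (hAB (p + 1))
      τ₂ := inclusion δ hδ (hA.isSubcomplex p) (hB.isSubcomplex p) (hAB p)
      τ₃ := grMap δ hδ hA hB hAB p
      comm₁₂ := rfl
      comm₂₃ := (cokernel.π_desc _ _ _).symm }
  exact HomologicalComplex.HomologySequence.quasiIso_τ₃ φ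
    (shortExact_inclusionSequence ..) (shortExact_inclusionSequence ..) (hstep (p + 1)) (hstep p)

end Subcomplexes

/-! ### Comparison of filtrations by the order of the pole -/

section PoleFiltrations

variable {M : ℕ → Type} [∀ k, AddCommGroup (M k)] [∀ k, Module ℂ (M k)]

/-- The part of degree at least `p` of a graded subspace. -/
def stupidTruncation (A : ∀ k, Submodule ℂ (M k)) (p : ℤ) (k : ℕ) : Submodule ℂ (M k) :=
  if p ≤ (k : ℤ) then A k else ⊥

/-- The filtration whose step `p` has the elements of order at most `k + s p` in the degrees
`k ≥ p`, where `L a` is thought of as the elements of order at most `a`. -/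
def poleFiltration (L : ℝ → ∀ k, Submodule ℂ (M k)) (s : ℤ → ℝ) (p : ℤ) :
    ∀ k, Submodule ℂ (M k) :=
  stupidTruncation (fun k => L (k + s p) k) p

theorem mem_stupidTruncation {A : ∀ k, Submodule ℂ (M k)} {p : ℤ} {k : ℕ} {x : M k} :
    x ∈ stupidTruncation A p k ↔ x = 0 ∨ p ≤ k ∧ x ∈ A k := by
  unfold stupidTruncation
  split_ifs with h
  · simpa [h] using fun hx : x = 0 => hx ▸ zero_mem (A k)
  · simp [h]

theorem stupidTruncation_le_stupidTruncation {A B : ∀ k, Submodule ℂ (M k)} {p q : ℤ} {k : ℕ}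
    (hqp : q ≤ p) (h : p ≤ k → A k ≤ B k) : stupidTruncation A p k ≤ stupidTruncation B q k :=
  fun _ hx => mem_stupidTruncation.2 <| (mem_stupidTruncation.1 hx).imp_right fun hpx =>
    ⟨hqp.trans hpx.1, h hpx.1 hpx.2⟩

variable {δ : ∀ k, M k →ₗ[ℂ] M (k + 1)}

theorem IsSubcomplex.stupidTruncation {A : ∀ k, Submodule ℂ (M k)} (hA : IsSubcomplex δ A)
    (p : ℤ) : IsSubcomplex δ (stupidTruncation A p) := by
  intro k x hx
  refine mem_stupidTruncation.2 ?_
  rcases mem_stupidTruncation.1 hx with rfl | ⟨hp, hx⟩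
  · exact Or.inl (map_zero _)
  · exact Or.inr ⟨by lia, hA k x hx⟩

theorem IsSubcomplex.isFiltration_stupidTruncation {A : ∀ k, Submodule ℂ (M k)}
    (hA : IsSubcomplex δ A) : IsFiltration δ (KontsevichYu.stupidTruncation A) where
  isSubcomplex := hA.stupidTruncation
  antitone _ _ hpq _ := stupidTruncation_le_stupidTruncation hpq fun _ => le_rfl

theorem QuotientExact.stupidTruncation {A B : ∀ k, Submodule ℂ (M k)} (h : QuotientExact δ A B)
    {p : ℤ} (hp : ∀ k : ℕ, p = k + 1 →
      ∀ x ∈ B (k + 1), δ (k + 1) x ∈ A (k + 2) → x ∈ A (k + 1)) :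
    QuotientExact δ (stupidTruncation A p) (stupidTruncation B p) where
  mem_zero x hx hδx := by
    unfold KontsevichYu.stupidTruncation at *
    split_ifs at hx hδx ⊢ with h₀ h₁
    · exact h.mem_zero x hx hδx
    · lia
    all_goals exact hx
  exists_sub_mem k x hx hδx := by
    obtain rfl | ⟨hpk, hx⟩ := mem_stupidTruncation.1 hx
    · exact ⟨0, zero_mem _, by simp⟩
    have hδx : δ (k + 1) x ∈ A (k + 2) := by
      obtain h₀ | hδx := mem_stupidTruncation.1 hδx
      · exact h₀ ▸ zero_mem _
      · exact hδx.2
    obtain hp' | hpk' : p = k + 1 ∨ p ≤ k := by lia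
    · refine ⟨0, zero_mem _, mem_stupidTruncation.2 (Or.inr ⟨hpk, ?_⟩)⟩
      simpa using hp k hp' x hx hδx
    · obtain ⟨y, hy, hxy⟩ := h.exists_sub_mem k x hx hδx
      exact ⟨y, mem_stupidTruncation.2 (Or.inr ⟨hpk', hy⟩),
        mem_stupidTruncation.2 (Or.inr ⟨hpk, hxy⟩)⟩

variable (δ) in
/-- The largest subcomplex of `(M, δ)` contained in a graded subspace. -/
def largestSubcomplex (A : ∀ k, Submodule ℂ (M k)) (k : ℕ) : Submodule ℂ (M k) :=
  A k ⊓ (A (k + 1)).comap (δ k)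

theorem isSubcomplex_largestSubcomplex (hδ : ∀ k (x : M k), δ (k + 1) (δ k x) = 0)
    (A : ∀ k, Submodule ℂ (M k)) : IsSubcomplex δ (largestSubcomplex δ A) :=
  fun k x hx => ⟨hx.2, by simp [hδ]⟩

/-- The subspaces `L a` of elements of order at most `a` increase with `a`, the differential `δ`
raises the order by at most `1`, and, up to elements of lower order, `h` is a homotopy from the
identity of `(M, δ)` to zero which lowers the order by `1`. -/
structure IsPoleHomotopy (δ : ∀ k, M k →ₗ[ℂ] M (k + 1)) (L : ℝ → ∀ k, Submodule ℂ (M k))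
    (h : ∀ k, M (k + 1) →ₗ[ℂ] M k) : Prop where
  monotone : Monotone L
  map_mem : ∀ {a k}, ∀ x ∈ L a k, δ k x ∈ L (a + 1) (k + 1)
  homotopy_mem : ∀ {a k}, ∀ x ∈ L (a + 1) (k + 1), h k x ∈ L a k
  sub_mem_zero : ∀ {a}, ∀ x ∈ L (a + 1) 0, x - h 0 (δ 0 x) ∈ L a 0
  sub_mem_succ : ∀ {a k}, ∀ x ∈ L (a + 1) (k + 1),
    x - δ k (h k x) - h (k + 1) (δ (k + 1) x) ∈ L a (k + 1)

namespace IsPoleHomotopy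

variable {L : ℝ → ∀ k, Submodule ℂ (M k)} {h : ∀ k, M (k + 1) →ₗ[ℂ] M k}

theorem le (H : IsPoleHomotopy δ L h) {a b : ℝ} (hab : a ≤ b) (k : ℕ) : L a k ≤ L b k :=
  H.monotone hab k

theorem mem_of_map_mem (H : IsPoleHomotopy δ L h) {a b : ℝ} {x : M 0} (hx : x ∈ L (a + 1) 0)
    (hδx : δ 0 x ∈ L (b + 1) 1) : x ∈ L b 0 := by
  have base {a b : ℝ} (hab : a ≤ b) (hx : x ∈ L (a + 1) 0) (hδx : δ 0 x ∈ L (b + 1) 1) :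
      x ∈ L b 0 := by
    have := add_mem (H.le hab 0 (H.sub_mem_zero x hx)) (H.homotopy_mem _ hδx)
    rwa [sub_add_cancel] at this
  obtain ⟨N, hN⟩ := exists_nat_ge (a - b)
  induction N generalizing b with
  | zero => exact base (by simpa using hN) hx hδx
  | succ N ih =>
    push_cast at hN
    exact base le_rfl (ih (H.le (by linarith) 1 hδx) (by linarith)) hδx

theorem exists_sub_mem (hδ : ∀ k (x : M k), δ (k + 1) (δ k x) = 0) (H : IsPoleHomotopy δ L h)
    {a b : ℝ} {k : ℕ} {x : M (k + 1)} (hx : x ∈ L (a + 1) (k + 1))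
    (hδx : δ (k + 1) x ∈ L (b + 1) (k + 2)) : ∃ ξ ∈ L a k, x - δ k ξ ∈ L b (k + 1) := by
  have base {a b : ℝ} (hab : a ≤ b) {x : M (k + 1)} (hx : x ∈ L (a + 1) (k + 1))
      (hδx : δ (k + 1) x ∈ L (b + 1) (k + 2)) : ∃ ξ ∈ L a k, x - δ k ξ ∈ L b (k + 1) := by
    have := add_mem (H.le hab _ (H.sub_mem_succ x hx)) (H.homotopy_mem _ hδx)
    rw [sub_add_cancel] at this
    exact ⟨h k x, H.homotopy_mem x hx, this⟩
  obtain ⟨N, hN⟩ := exists_nat_ge (a - b)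
  induction N generalizing b with
  | zero => exact base (by simpa using hN) hx hδx
  | succ N ih =>
    push_cast at hN
    obtain hab | hba := le_total a b
    · exact base hab hx hδx
    · obtain ⟨ξ, hξ, hxξ⟩ := ih (b := b + 1) (H.le (by linarith) _ hδx) (by linarith)
      have hδ' : δ (k + 1) (x - δ k ξ) ∈ L (b + 1) (k + 2) := by rwa [map_sub, hδ, sub_zero]
      obtain ⟨ξ', hξ', hxξ'⟩ := base le_rfl hxξ hδ'
      refine ⟨ξ + ξ', add_mem hξ (H.le hba k hξ'), ?_⟩
      rwa [map_add, ← sub_sub]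

theorem isFiltration_poleFiltration (H : IsPoleHomotopy δ L h) {s : ℤ → ℝ} (hs : Antitone s) :
    IsFiltration δ (poleFiltration L s) where
  isSubcomplex p := by
    refine IsSubcomplex.stupidTruncation (fun k x hx => ?_) p
    have := H.map_mem x hx
    push_cast
    rwa [add_right_comm]
  antitone p q hpq k := stupidTruncation_le_stupidTruncation hpq fun _ =>
    H.le (by linarith [hs hpq]) k

theorem quotientExact_shift (hδ : ∀ k (x : M k), δ (k + 1) (δ k x) = 0)
    (H : IsPoleHomotopy δ L h) {a b : ℝ} :
    QuotientExact δ (fun k => L (k + a) k) (fun k => L (k + b) k) where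
  mem_zero x hx hδx := by
    refine H.mem_of_map_mem (a := b) (H.le (by simp) 0 hx) ?_
    simpa [add_comm] using hδx
  exists_sub_mem k x hx hδx := by
    refine H.exists_sub_mem hδ ?_ ?_
    · convert hx using 2
      push_cast
      ring
    · convert hδx using 2
      push_cast
      ring

theorem isFilteredQuasiIso_poleFiltration (hδ : ∀ k (x : M k), δ (k + 1) (δ k x) = 0)
    (H : IsPoleHomotopy δ L h) {s t : ℤ → ℝ} (hs : Antitone s) (ht : Antitone t) (hst : s ≤ t)
    (heq : ∀ p, 0 < p → s p = t p) :
    IsFilteredQuasiIso δ hδ (poleFiltration L s) (poleFiltration L t) := by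
  refine isFilteredQuasiIso_of_quotientExact δ hδ (H.isFiltration_poleFiltration hs)
    (H.isFiltration_poleFiltration ht) (fun p k => ?_) fun p => ?_
  · exact stupidTruncation_le_stupidTruncation le_rfl fun _ => H.le (by linarith [hst p]) k
  · refine (H.quotientExact_shift hδ).stupidTruncation fun k hp x hx _ => ?_
    rwa [heq p (by lia)]

theorem quotientExact_largestSubcomplex (hδ : ∀ k (x : M k), δ (k + 1) (δ k x) = 0)
    (H : IsPoleHomotopy δ L h) {μ a : ℝ} :
    QuotientExact δ (largestSubcomplex δ (L μ)) (fun k => L (k + a) k) where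
  mem_zero x hx hδx := by
    refine ⟨H.mem_of_map_mem (a := a) (H.le (by simp) 0 hx) (H.le (by simp) 1 hδx.1), hδx.1⟩
  exists_sub_mem k x hx hδx := by
    obtain ⟨ξ, hξ, hxξ⟩ := H.exists_sub_mem hδ (a := k + a) (b := μ - 1)
      (H.le (by push_cast; linarith) _ hx) (by simpa using hδx.1)
    refine ⟨ξ, hξ, H.le (by linarith) _ hxξ, ?_⟩
    simpa [hδ] using hδx.1

theorem largestSubcomplex_le (H : IsPoleHomotopy δ L h) {μ a : ℝ} (hμ : μ ≤ 1 + a) (k : ℕ) :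
    largestSubcomplex δ (L μ) k ≤ L (k + a) k := by
  intro x ⟨hx, hδx⟩
  cases k with
  | zero =>
    have := H.mem_of_map_mem (a := μ) (b := μ - 1) (H.le (by simp) 0 hx) (by simpa using hδx)
    exact H.le (by push_cast; linarith) 0 this
  | succ k => exact H.le (by push_cast; linarith [k.cast_nonneg (α := ℝ)]) (k + 1) hx

theorem isFilteredQuasiIso_largestSubcomplex (hδ : ∀ k (x : M k), δ (k + 1) (δ k x) = 0)
    (H : IsPoleHomotopy δ L h) {s : ℤ → ℝ} (hs : Antitone s) {μ : ℝ}
    (hle : ∀ p ≤ 0, μ ≤ 1 + s p) (heq : ∀ p, 0 < p → p + s p = μ) :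
    IsFilteredQuasiIso δ hδ (stupidTruncation (largestSubcomplex δ (L μ)))
      (poleFiltration L s) := by
  refine isFilteredQuasiIso_of_quotientExact δ hδ
    (isSubcomplex_largestSubcomplex hδ _).isFiltration_stupidTruncation
    (H.isFiltration_poleFiltration hs) (fun p k => ?_) fun p => ?_
  · refine stupidTruncation_le_stupidTruncation le_rfl fun hpk => ?_
    obtain hp | hp := le_or_gt p 0
    · exact H.largestSubcomplex_le (hle p hp) k
    · have hpk : (p : ℝ) ≤ k := mod_cast hpk
      exact inf_le_left.trans (H.le (by linarith [heq p hp]) k)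
  · refine (H.quotientExact_largestSubcomplex hδ).stupidTruncation fun k hp x hx hδx => ?_
    have hμ : ((k + 1 : ℕ) : ℝ) + s p = μ := by
      rw [← heq p (by lia), hp]
      push_cast
      rfl
    exact ⟨hμ ▸ hx, hδx.1⟩

end IsPoleHomotopy

end PoleFiltrations

/-! ### The interior product -/

section InteriorProduct

variable {E : Type*} [NormedAddCommGroup E] [NormedSpace ℂ E] {k : ℕ}

theorem wedge_apply (a : E →L[ℂ] ℂ) (w : E [⋀^Fin k]→L[ℂ] ℂ) (v : Fin (k + 1) → E) :
    wedge a w v = ∑ i : Fin (k + 1), (-1 : ℂ) ^ i.val * (a (v i) * w (i.removeNth v)) := by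
  rw [wedge, ContinuousAlternatingMap.alternatizeUncurryFin_apply]
  exact Finset.sum_congr rfl fun i _ => by simp

theorem curryLeft_wedge_zero (a : E →L[ℂ] ℂ) (w : E [⋀^Fin 0]→L[ℂ] ℂ) (v : E) :
    (wedge a w).curryLeft v = a v • w := by
  ext u
  rw [ContinuousAlternatingMap.curryLeft_apply_apply, wedge_apply]
  simp

theorem curryLeft_wedge_add_wedge_curryLeft (a : E →L[ℂ] ℂ) (w : E [⋀^Fin (k + 1)]→L[ℂ] ℂ)
    (v : E) : (wedge a w).curryLeft v + wedge a (w.curryLeft v) = a v • w := by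
  ext u
  have hzero : Fin.removeNth 0 (Matrix.vecCons v u) = u := Fin.removeNth_zero _
  have hsucc (j : Fin (k + 1)) :
      j.succ.removeNth (Matrix.vecCons v u : Fin (k + 2) → E) =
        Matrix.vecCons v (j.removeNth u) := by
    ext i
    refine Fin.cases ?_ (fun i => ?_) i <;> simp [Fin.removeNth]
  simp only [ContinuousAlternatingMap.add_apply, ContinuousAlternatingMap.smul_apply,
    ContinuousAlternatingMap.curryLeft_apply_apply, wedge_apply, Fin.sum_univ_succ (n := k + 1),
    hzero, hsucc]
  simp [pow_succ]

theorem analyticAt_clm_apply {G H K : Type*} [NormedAddCommGroup G] [NormedSpace ℂ G]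
    [NormedAddCommGroup H] [NormedSpace ℂ H] [NormedAddCommGroup K] [NormedSpace ℂ K]
    {a : G → H →L[ℂ] K} {V : G → H} {z : G} (ha : AnalyticAt ℂ a z) (hV : AnalyticAt ℂ V z) :
    AnalyticAt ℂ (fun z => a z (V z)) z :=
  ((ContinuousLinearMap.id ℂ (H →L[ℂ] K)).analyticAt_bilinear (a z, V z)).comp₂ ha hV

theorem analyticAt_curryLeft {G : Type*} [NormedAddCommGroup G] [NormedSpace ℂ G]
    {η : G → E [⋀^Fin (k + 1)]→L[ℂ] ℂ} {V : G → E} {z : G}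
    (hη : AnalyticAt ℂ η z) (hV : AnalyticAt ℂ V z) :
    AnalyticAt ℂ (fun z => (η z).curryLeft (V z)) z := by
  have h := @ContinuousLinearMap.analyticAt ℂ _ (E [⋀^Fin (k + 1)]→L[ℂ] ℂ) _ _
    (E →L[ℂ] E [⋀^Fin k]→L[ℂ] ℂ) _ _ (ContinuousAlternatingMap.curryLeftLI
      (𝕜 := ℂ) (E := E) (F := ℂ) (n := k)).toContinuousLinearMap (η z)
  exact analyticAt_clm_apply (h.comp (f := η) (x := z) hη) hV

end InteriorProduct

section InteriorProductOfGerms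

variable {n : ℕ} {S : Finset (Fin n)} {V : (Fin n → ℂ) → Fin n → ℂ}
  {F : (Fin n → ℂ) → ℂ} {k : ℕ}

/-- The interior product by the holomorphic vector field `V` on germs of holomorphic forms defined
off the coordinate hyperplanes `z_i = 0`, `i ∈ S`. -/
def interiorProduct (hV : ∀ᶠ z in nhdsOff S, AnalyticAt ℂ V z) (k : ℕ) :
    HolForms S (k + 1) →ₗ[ℂ] HolForms S k where
  toFun γ := ⟨Germ.map₂ (fun v w => w.curryLeft v) (V : Germ (nhdsOff S) (Fin n → ℂ)) γ.1, by
    obtain ⟨_, η, rfl, hη⟩ := γ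
    exact ⟨fun z => (η z).curryLeft (V z), rfl,
      (hη.and hV).mono fun z h => analyticAt_curryLeft h.1 h.2⟩⟩
  map_add' := by
    rintro ⟨_, η, rfl, hη⟩ ⟨_, θ, rfl, hθ⟩
    rfl
  map_smul' := by
    rintro c ⟨_, η, rfl, hη⟩
    rfl

theorem coe_interiorProduct (hV : ∀ᶠ z in nhdsOff S, AnalyticAt ℂ V z) {γ : HolForms S (k + 1)}
    {η : (Fin n → ℂ) → Form n (k + 1)} (h : (η : Germ (nhdsOff S) (Form n (k + 1))) = γ.1) :
    (↑(fun z => (η z).curryLeft (V z)) : Germ (nhdsOff S) (Form n k)) =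
      (interiorProduct hV k γ).1 := by
  obtain ⟨_, _⟩ := γ
  subst h
  rfl

theorem coe_twistedD (hF : ∀ᶠ z in nhdsOff S, AnalyticAt ℂ F z) (u v : ℂ) {γ : HolForms S k}
    {η : (Fin n → ℂ) → Form n k} (h : (η : Germ (nhdsOff S) (Form n k)) = γ.1) :
    (↑(fun z => u • extDeriv η z + v • wedge (fderiv ℂ F z) (η z)) :
      Germ (nhdsOff S) (Form n (k + 1))) = (twistedD S F hF u v k γ).1 := by
  obtain ⟨_, _⟩ := γ
  subst h
  rfl

theorem interiorProduct_twistedD_zero (hV : ∀ᶠ z in nhdsOff S, AnalyticAt ℂ V z)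
    (hF : ∀ᶠ z in nhdsOff S, AnalyticAt ℂ F z) (hVF : ∀ᶠ z in nhdsOff S, fderiv ℂ F z (V z) = 1)
    (γ : HolForms S 0) : interiorProduct hV 0 (twistedD S F hF 0 1 0 γ) = γ := by
  obtain ⟨η, hη, -⟩ := γ.2
  refine Subtype.ext ?_
  rw [← coe_interiorProduct hV (coe_twistedD hF 0 1 hη), ← hη]
  refine Germ.coe_eq.2 ?_
  filter_upwards [hVF] with z hz
  rw [zero_smul, zero_add, one_smul, curryLeft_wedge_zero, hz, one_smul]

theorem interiorProduct_twistedD_add_twistedD_interiorProduct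
    (hV : ∀ᶠ z in nhdsOff S, AnalyticAt ℂ V z) (hF : ∀ᶠ z in nhdsOff S, AnalyticAt ℂ F z)
    (hVF : ∀ᶠ z in nhdsOff S, fderiv ℂ F z (V z) = 1) (γ : HolForms S (k + 1)) :
    interiorProduct hV (k + 1) (twistedD S F hF 0 1 (k + 1) γ) +
      twistedD S F hF 0 1 k (interiorProduct hV k γ) = γ := by
  obtain ⟨η, hη, -⟩ := γ.2
  refine Subtype.ext ?_
  rw [Submodule.coe_add, ← coe_interiorProduct hV (coe_twistedD hF 0 1 hη),
    ← coe_twistedD hF 0 1 (coe_interiorProduct hV hη), ← hη]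
  refine Germ.coe_eq.2 ?_
  filter_upwards [hVF] with z hz
  simp only [zero_smul, zero_add, one_smul]
  rw [curryLeft_wedge_add_wedge_curryLeft, hz, one_smul]

theorem twistedD_eq_smul_add_smul (hF : ∀ᶠ z in nhdsOff S, AnalyticAt ℂ F z) (u v : ℂ)
    (γ : HolForms S k) :
    twistedD S F hF u v k γ = u • twistedD S F hF 1 0 k γ + v • twistedD S F hF 0 1 k γ := by
  obtain ⟨_, η, rfl, hη⟩ := γ
  refine Subtype.ext (Germ.coe_eq.2 (Eventually.of_forall fun z => ?_))
  change u • extDeriv η z + v • wedge (fderiv ℂ F z) (η z) =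
    u • ((1 : ℂ) • extDeriv η z + (0 : ℂ) • wedge (fderiv ℂ F z) (η z)) +
      v • ((0 : ℂ) • extDeriv η z + (1 : ℂ) • wedge (fderiv ℂ F z) (η z))
  simp

end InteriorProductOfGerms

/-! ### Functions with poles along coordinate hyperplanes -/

section PolarFunctions

variable {n : ℕ} {S : Finset (Fin n)} {m m' : Fin n → ℤ} {b b' c : (Fin n → ℂ) → ℂ}
  {z : Fin n → ℂ}

theorem analyticAt_coord (i : Fin n) (z : Fin n → ℂ) :
    AnalyticAt ℂ (fun z : Fin n → ℂ => z i) z :=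
  (ContinuousLinearMap.proj (R := ℂ) (φ := fun _ : Fin n => ℂ) i).analyticAt z

theorem eventually_mem_offHyperplanes : ∀ᶠ z in nhdsOff S, z ∈ offHyperplanes S :=
  eventually_mem_nhdsWithin

theorem nhdsOff_le_nhds : nhdsOff S ≤ 𝓝 0 := nhdsWithin_le_nhds

variable (S m) in
/-- The Laurent monomial `∏_{i ∈ S} z_i ^ m_i`, an equation of the divisor `∑ m_i D_i`. -/
def laurentMonomial (z : Fin n → ℂ) : ℂ := ∏ i ∈ S, z i ^ m i

theorem laurentMonomial_ne_zero (hz : z ∈ offHyperplanes S) : laurentMonomial S m z ≠ 0 :=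
  Finset.prod_ne_zero_iff.2 fun i hi => zpow_ne_zero _ (hz i hi)

theorem laurentMonomial_add (hz : z ∈ offHyperplanes S) :
    laurentMonomial S (m + m') z = laurentMonomial S m z * laurentMonomial S m' z := by
  simp only [laurentMonomial, ← Finset.prod_mul_distrib, Pi.add_apply]
  exact Finset.prod_congr rfl fun i hi => zpow_add₀ (hz i hi) _ _

theorem laurentMonomial_neg : laurentMonomial S (-m) z = (laurentMonomial S m z)⁻¹ := by
  simp [laurentMonomial]

theorem analyticAt_laurentMonomial (hm : ∀ i ∈ S, 0 ≤ m i) :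
    AnalyticAt ℂ (laurentMonomial S m) z :=
  Finset.analyticAt_fun_prod S fun i hi => (analyticAt_coord i z).zpow_nonneg (hm i hi)

variable (S m) in
/-- The germs of functions with a pole of order at most `m_i` along `z_i = 0`, for `i ∈ S`: the
product with `laurentMonomial S m` extends holomorphically. -/
def polarFunctions : Submodule ℂ ((Fin n → ℂ) → ℂ) where
  carrier := {b | ∃ c : (Fin n → ℂ) → ℂ, AnalyticAt ℂ c 0 ∧
    ∀ᶠ z in nhdsOff S, laurentMonomial S m z * b z = c z}
  zero_mem' := ⟨0, analyticAt_const, Eventually.of_forall fun z => by simp⟩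
  add_mem' := by
    rintro b b' ⟨c, hc, h⟩ ⟨c', hc', h'⟩
    refine ⟨c + c', hc.add hc', ?_⟩
    filter_upwards [h, h'] with z h h'
    simp [mul_add, h, h']
  smul_mem' := by
    rintro t b ⟨c, hc, h⟩
    refine ⟨t • c, hc.const_smul, ?_⟩
    filter_upwards [h] with z h
    simp [mul_left_comm, h]

theorem mem_polarFunctions_congr (h : b =ᶠ[nhdsOff S] b') :
    b ∈ polarFunctions S m ↔ b' ∈ polarFunctions S m := by
  refine exists_congr fun c => and_congr_right fun _ => eventually_congr ?_
  filter_upwards [h] with z hz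
  rw [hz]

theorem mul_mem_polarFunctions (h : b ∈ polarFunctions S m) (h' : b' ∈ polarFunctions S m') :
    b * b' ∈ polarFunctions S (m + m') := by
  obtain ⟨c, hc, h⟩ := h
  obtain ⟨c', hc', h'⟩ := h'
  refine ⟨c * c', hc.mul hc', ?_⟩
  filter_upwards [h, h', eventually_mem_offHyperplanes] with z h h' hz
  rw [laurentMonomial_add hz, Pi.mul_apply, Pi.mul_apply, ← h, ← h']
  ring

theorem polarFunctions_mono (hm : ∀ i ∈ S, m i ≤ m' i) :
    polarFunctions S m ≤ polarFunctions S m' := by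
  rintro b ⟨c, hc, h⟩
  refine ⟨laurentMonomial S (m' - m) * c,
    (analyticAt_laurentMonomial fun i hi => sub_nonneg.2 (hm i hi)).mul hc, ?_⟩
  filter_upwards [h, eventually_mem_offHyperplanes] with z h hz
  rw [Pi.mul_apply, ← h, ← mul_assoc, ← laurentMonomial_add hz, sub_add_cancel]

theorem mem_polarFunctions_zero (hb : AnalyticAt ℂ b 0) : b ∈ polarFunctions S 0 :=
  ⟨b, hb, Eventually.of_forall fun z => by simp [laurentMonomial]⟩

/-! ### Derivatives along the logarithmic frame -/

theorem analyticAt_logFrame (i : Fin n) (z : Fin n → ℂ) :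
    AnalyticAt ℂ (fun z => logFrame S z i) z := by
  refine ((ContinuousLinearMap.single ℂ (fun _ : Fin n => ℂ) i).analyticAt _).comp
    (f := fun z : Fin n → ℂ => if i ∈ S then z i else 1) (x := z) ?_
  split_ifs
  · exact analyticAt_coord i z
  · exact analyticAt_const

theorem lieBracket_logFrame (i j : Fin n) (z : Fin n → ℂ) :
    VectorField.lieBracket ℂ (fun z => logFrame S z i) (fun z => logFrame S z j) z = 0 := by
  have hfderiv (i : Fin n) : fderiv ℂ (fun z => logFrame S z i) z =
      (ContinuousLinearMap.single ℂ (fun _ : Fin n => ℂ) i).comp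
        (if i ∈ S then ContinuousLinearMap.proj i else 0) := by
    refine ((ContinuousLinearMap.single ℂ (fun _ : Fin n => ℂ) i).hasFDerivAt.comp z
      (f := fun z : Fin n → ℂ => if i ∈ S then z i else 1) ?_).fderiv
    split_ifs
    · exact hasFDerivAt_apply i z
    · exact hasFDerivAt_const (1 : ℂ) z
  rw [VectorField.lieBracket, hfderiv, hfderiv]
  obtain rfl | hij := eq_or_ne i j
  · simp
  · have hi : logFrame S z i j = 0 := by simp [logFrame, hij.symm]
    have hj : logFrame S z j i = 0 := by simp [logFrame, hij]
    split_ifs <;> simp [hi, hj]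

variable (S) in
/-- The derivative of a function along a vector field of the logarithmic frame. -/
def frameDeriv (i : Fin n) (b : (Fin n → ℂ) → ℂ) (z : Fin n → ℂ) : ℂ :=
  fderiv ℂ b z (logFrame S z i)

theorem analyticAt_frameDeriv (hb : AnalyticAt ℂ b z) (i : Fin n) :
    AnalyticAt ℂ (frameDeriv S i b) z :=
  analyticAt_clm_apply hb.fderiv (analyticAt_logFrame i z)

theorem frameDeriv_mul (hb : DifferentiableAt ℂ b z) (hc : DifferentiableAt ℂ c z) (i : Fin n) :
    frameDeriv S i (b * c) z = b z * frameDeriv S i c z + c z * frameDeriv S i b z := by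
  simp [frameDeriv, fderiv_mul hb hc]

theorem hasFDerivAt_laurentMonomial (hz : z ∈ offHyperplanes S) :
    HasFDerivAt (laurentMonomial S m)
      (∑ j ∈ S, (∏ k ∈ S.erase j, z k ^ m k) •
        (m j * z j ^ (m j - 1)) • ContinuousLinearMap.proj (R := ℂ) (φ := fun _ : Fin n => ℂ) j)
      z :=
  HasFDerivAt.finsetProd fun j hj => HasDerivAt.comp_hasFDerivAt (f := fun w : Fin n → ℂ => w j) z
    (hasDerivAt_zpow (m j) (z j) (Or.inl (hz j hj))) (hasFDerivAt_apply j z)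

theorem frameDeriv_laurentMonomial (hz : z ∈ offHyperplanes S) (i : Fin n) :
    frameDeriv S i (laurentMonomial S m) z =
      (if i ∈ S then (m i : ℂ) else 0) * laurentMonomial S m z := by
  rw [frameDeriv, (hasFDerivAt_laurentMonomial hz).fderiv]
  have hj (j : Fin n) (hji : j ≠ i) : logFrame S z i j = 0 := by simp [logFrame, hji]
  simp only [sum_apply, smul_apply, ContinuousLinearMap.proj_apply,
    smul_eq_mul]
  split_ifs with hi
  · rw [Finset.sum_eq_single_of_mem i hi fun j _ hji => by rw [hj j hji]; simp, laurentMonomial,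
      ← Finset.mul_prod_erase S _ hi]
    have hzi : z i ^ m i = z i ^ (m i - 1) * z i := by
      rw [← zpow_add_one₀ (hz i hi), sub_add_cancel]
    simp only [logFrame, hi, if_true, Pi.single_eq_same, hzi]
    ring
  · rw [zero_mul]
    refine Finset.sum_eq_zero fun j hjS => ?_
    rw [hj j (ne_of_mem_of_not_mem hjS hi)]
    simp

theorem eventually_laurentMonomial_mul_frameDeriv (hc : AnalyticAt ℂ c 0)
    (h : ∀ᶠ z in nhdsOff S, laurentMonomial S m z * b z = c z) (i : Fin n) :
    ∀ᶠ z in nhdsOff S, laurentMonomial S m z * frameDeriv S i b z =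
      frameDeriv S i c z - (if i ∈ S then (m i : ℂ) else 0) * c z := by
  filter_upwards [eventually_nhdsOff_nhds h, eventually_mem_offHyperplanes,
    nhdsOff_le_nhds hc.eventually_analyticAt] with z h hz hcz
  have hbc : b =ᶠ[𝓝 z] laurentMonomial S (-m) * c := by
    filter_upwards [h, (isOpen_offHyperplanes S).mem_nhds hz] with w hw hwS
    rw [Pi.mul_apply, laurentMonomial_neg, ← hw, inv_mul_cancel_left₀ (laurentMonomial_ne_zero hwS)]
  have hbc' : frameDeriv S i b z = frameDeriv S i (laurentMonomial S (-m) * c) z := by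
    rw [frameDeriv, frameDeriv, hbc.fderiv_eq]
  rw [hbc', frameDeriv_mul (hasFDerivAt_laurentMonomial hz).differentiableAt hcz.differentiableAt,
    frameDeriv_laurentMonomial hz, laurentMonomial_neg]
  have := laurentMonomial_ne_zero (m := m) hz
  split_ifs
  · push_cast [Pi.neg_apply]
    field_simp
    ring
  · field_simp
    ring

theorem frameDeriv_mem_polarFunctions (h : b ∈ polarFunctions S m) (i : Fin n) :
    frameDeriv S i b ∈ polarFunctions S m := by
  obtain ⟨c, hc, h⟩ := h
  exact ⟨_, (analyticAt_frameDeriv hc i).sub (analyticAt_const.mul hc),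
    eventually_laurentMonomial_mul_frameDeriv hc h i⟩

end PolarFunctions

/-! ### Operations on logarithmic forms -/

section LogForms

variable {n : ℕ} {S : Finset (Fin n)} {m m' e : Fin n → ℤ} {k : ℕ} {F g : (Fin n → ℂ) → ℂ}

theorem mem_logForms_iff {γ : HolForms S k} {η : (Fin n → ℂ) → Form n k}
    (h : (η : Germ (nhdsOff S) (Form n k)) = γ.1) :
    γ ∈ logForms S m k ↔
      ∀ J : Fin k → Fin n, (fun z => η z fun a => logFrame S z (J a)) ∈ polarFunctions S m := by
  refine ⟨fun ⟨θ, hθ, hmem⟩ J => ?_, fun hmem => ⟨η, h, hmem⟩⟩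
  refine (mem_polarFunctions_congr ?_).1 (hmem J)
  filter_upwards [Germ.coe_eq.1 (hθ.trans h.symm)] with z hz
  rw [hz]

theorem logForms_mono (h : ∀ i ∈ S, m i ≤ m' i) : logForms S m k ≤ logForms S m' k :=
  fun _ ⟨η, hη, hmem⟩ => ⟨η, hη, fun J => polarFunctions_mono h (hmem J)⟩

theorem extDeriv_mem_logForms (hF : ∀ᶠ z in nhdsOff S, AnalyticAt ℂ F z) {γ : HolForms S k}
    (h : γ ∈ logForms S m k) : twistedD S F hF 1 0 k γ ∈ logForms S m (k + 1) := by
  obtain ⟨η, hη, han⟩ := γ.2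
  refine (mem_logForms_iff (coe_twistedD hF 1 0 hη)).2 fun J => ?_
  -- The logarithmic frame commutes, so `dη` on it is an alternating sum of frame derivatives.
  have hsum : (∑ i : Fin (k + 1), (-1 : ℂ) ^ i.val •
      frameDeriv S (J i) fun z => η z (i.removeNth fun a => logFrame S z (J a))) ∈
      polarFunctions S m :=
    sum_mem fun i _ => Submodule.smul_mem _ _ <|
      frameDeriv_mem_polarFunctions ((mem_logForms_iff hη).1 h (i.removeNth J)) (J i)
  refine (mem_polarFunctions_congr ?_).1 hsum
  filter_upwards [han] with z hz
  have := extDeriv_apply_vectorField_of_pairwise_commute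
    (V := fun a x => logFrame S x (J a)) hz.differentiableAt
    (fun a => (analyticAt_logFrame (S := S) (J a) z).differentiableAt)
    fun i j _ => lieBracket_logFrame (J i) (J j) z
  simp [this, frameDeriv]

theorem dF_mem_logForms (hF : ∀ᶠ z in nhdsOff S, AnalyticAt ℂ F z) (hFe : F ∈ polarFunctions S e)
    {γ : HolForms S k} (h : γ ∈ logForms S m k) :
    twistedD S F hF 0 1 k γ ∈ logForms S (e + m) (k + 1) := by
  obtain ⟨η, hη, -⟩ := γ.2
  refine (mem_logForms_iff (coe_twistedD hF 0 1 hη)).2 fun J => ?_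
  have hsum : (∑ i : Fin (k + 1), (-1 : ℂ) ^ i.val • (frameDeriv S (J i) F *
      fun z => η z (i.removeNth fun a => logFrame S z (J a)))) ∈ polarFunctions S (e + m) :=
    sum_mem fun i _ => Submodule.smul_mem _ _ <|
      mul_mem_polarFunctions (frameDeriv_mem_polarFunctions hFe (J i))
        ((mem_logForms_iff hη).1 h (i.removeNth J))
  convert hsum using 1
  ext z
  simp [wedge_apply, frameDeriv]

theorem interiorProduct_mem_logForms {i : Fin n}
    (hV : ∀ᶠ z in nhdsOff S, AnalyticAt ℂ (fun z => g z • logFrame S z i) z)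
    (hg : g ∈ polarFunctions S m') {γ : HolForms S (k + 1)} (h : γ ∈ logForms S m (k + 1)) :
    interiorProduct hV k γ ∈ logForms S (m' + m) k := by
  obtain ⟨η, hη, -⟩ := γ.2
  refine (mem_logForms_iff (coe_interiorProduct hV hη)).2 fun J => ?_
  convert mul_mem_polarFunctions hg ((mem_logForms_iff hη).1 h (Matrix.vecCons i J)) using 1
  ext z
  have hJ : (fun a => logFrame S z (Matrix.vecCons i J a)) =
      Matrix.vecCons (logFrame S z i) fun a => logFrame S z (J a) := by
    ext a : 1
    refine Fin.cases ?_ (fun a => ?_) a <;> simp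
  simp [hJ]

variable (S e F) in
/-- The function `F` has a pole along `∑ e_i D_i`, and its derivative along the `i`-th vector field
of the logarithmic frame has no zero off the `D_j` and a pole of order exactly `e_j` along each. -/
structure HasLogPole (i : Fin n) : Prop where
  mem_polarFunctions : F ∈ polarFunctions S e
  inv_frameDeriv_mem : (frameDeriv S i F)⁻¹ ∈ polarFunctions S (-e)
  frameDeriv_ne_zero : ∀ᶠ z in nhdsOff S, frameDeriv S i F z ≠ 0

theorem hasLogPole_of_laurentMonomial_mul_eq {w : (Fin n → ℂ) → ℂ} (hw : AnalyticAt ℂ w 0)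
    (hw0 : w 0 ≠ 0) {i : Fin n} (hi : i ∈ S) (hei : e i ≠ 0)
    (h : ∀ᶠ z in nhdsOff S, laurentMonomial S e z * F z = w z) : HasLogPole S e F i := by
  -- The derivative of `w` along `z_i ∂/∂z_i` vanishes at the origin, so `c 0 = -(e i) * w 0 ≠ 0`.
  let c : (Fin n → ℂ) → ℂ := fun z => frameDeriv S i w z - e i * w z
  have hc : AnalyticAt ℂ c 0 := (analyticAt_frameDeriv hw i).sub (analyticAt_const.mul hw)
  have hc0 : c 0 ≠ 0 := by simp [c, frameDeriv, logFrame, hi, hei, hw0]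
  have hFc : ∀ᶠ z in nhdsOff S, laurentMonomial S e z * frameDeriv S i F z = c z := by
    simpa only [hi, if_true] using eventually_laurentMonomial_mul_frameDeriv hw h i
  refine ⟨⟨w, hw, h⟩, ⟨c⁻¹, hc.inv hc0, ?_⟩, ?_⟩
  · filter_upwards [hFc] with z hz
    rw [Pi.inv_apply, Pi.inv_apply, laurentMonomial_neg, ← mul_inv, hz]
  · filter_upwards [hFc, nhdsOff_le_nhds (hc.continuousAt.eventually_ne hc0)] with z hz hcz h0
    exact hcz (by rw [← hz, h0, mul_zero])

end LogForms

/-! ### The pole homotopy and the filtrations of the irregular Hodge theory -/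

section LogP

variable {n : ℕ} {S : Finset (Fin n)} {e : Fin n → ℕ} {k : ℕ} {F : (Fin n → ℂ) → ℂ}

theorem monotone_logP : Monotone (logP S e) :=
  fun _ _ h _ => logForms_mono fun _ _ => Int.floor_mono (by gcongr)

theorem logP_add_one (a : ℝ) :
    logP S e (a + 1) k = logForms S ((fun i => (e i : ℤ)) + fun i => ⌊a * e i⌋) k := by
  unfold logP
  congr 1
  ext i
  rw [add_one_mul, Int.floor_add_natCast, add_comm, Pi.add_apply]

theorem dF_mem_logP (hF : ∀ᶠ z in nhdsOff S, AnalyticAt ℂ F z)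
    (hFe : F ∈ polarFunctions S fun i => e i) {a : ℝ} {γ : HolForms S k} (h : γ ∈ logP S e a k) :
    twistedD S F hF 0 1 k γ ∈ logP S e (a + 1) (k + 1) := by
  rw [logP_add_one]
  exact dF_mem_logForms hF hFe h

theorem interiorProduct_mem_logP {g : (Fin n → ℂ) → ℂ} {i : Fin n}
    (hV : ∀ᶠ z in nhdsOff S, AnalyticAt ℂ (fun z => g z • logFrame S z i) z)
    (hg : g ∈ polarFunctions S (-fun i => (e i : ℤ))) {a : ℝ} {γ : HolForms S (k + 1)}
    (h : γ ∈ logP S e (a + 1) (k + 1)) : interiorProduct hV k γ ∈ logP S e a k := by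
  rw [logP_add_one] at h
  have := interiorProduct_mem_logForms hV hg h
  rwa [neg_add_cancel_left] at this

theorem twistedD_mem_logP (hF : ∀ᶠ z in nhdsOff S, AnalyticAt ℂ F z)
    (hFe : F ∈ polarFunctions S fun i => e i) (u v : ℂ) {a : ℝ} {γ : HolForms S k}
    (h : γ ∈ logP S e a k) : twistedD S F hF u v k γ ∈ logP S e (a + 1) (k + 1) := by
  rw [twistedD_eq_smul_add_smul]
  exact add_mem
    (Submodule.smul_mem _ _ (monotone_logP (by linarith) _ (extDeriv_mem_logForms hF h)))
    (Submodule.smul_mem _ _ (dF_mem_logP hF hFe h))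

theorem HasLogPole.exists_isPoleHomotopy {i : Fin n} (H : HasLogPole S (fun j => e j) F i)
    (hF : ∀ᶠ z in nhdsOff S, AnalyticAt ℂ F z) (u : ℂ) {v : ℂ} (hv : v ≠ 0) :
    ∃ h, IsPoleHomotopy (M := fun k => HolForms S k) (twistedD S F hF u v) (logP S e) h := by
  have hV : ∀ᶠ z in nhdsOff S,
      AnalyticAt ℂ (fun z => (frameDeriv S i F)⁻¹ z • logFrame S z i) z := by
    filter_upwards [hF, H.frameDeriv_ne_zero] with z hFz hz
    exact ((analyticAt_frameDeriv hFz i).inv hz).smul (analyticAt_logFrame i z)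
  have hVF : ∀ᶠ z in nhdsOff S, fderiv ℂ F z ((frameDeriv S i F)⁻¹ z • logFrame S z i) = 1 := by
    filter_upwards [H.frameDeriv_ne_zero] with z hz
    rw [map_smul, Pi.inv_apply, smul_eq_mul]
    exact inv_mul_cancel₀ hz
  have hι {a k} {γ : HolForms S (k + 1)} (h : γ ∈ logP S e (a + 1) (k + 1)) :
      interiorProduct hV k γ ∈ logP S e a k := interiorProduct_mem_logP hV H.inv_frameDeriv_mem h
  have hd {a k} {γ : HolForms S k} (h : γ ∈ logP S e a k) :
      twistedD S F hF 1 0 k γ ∈ logP S e a (k + 1) := extDeriv_mem_logForms hF h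
  refine ⟨fun k => v⁻¹ • interiorProduct hV k, monotone_logP,
    fun γ h => twistedD_mem_logP hF H.mem_polarFunctions u v h,
    fun γ h => Submodule.smul_mem _ _ (hι h), fun γ h => ?_, fun {a k} γ h => ?_⟩
  · -- The difference is `-(u / v) ι d γ`.
    convert Submodule.smul_mem _ (-(v⁻¹ * u)) (hι (hd h)) using 1
    rw [twistedD_eq_smul_add_smul, LinearMap.smul_apply, map_add, map_smul, map_smul, smul_add,
      smul_smul v⁻¹ v, inv_mul_cancel₀ hv, one_smul, interiorProduct_twistedD_zero hV hF hVF]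
    module
  · -- The difference is `-(u / v) (d ι γ + ι d γ)`.
    convert Submodule.smul_mem _ (-(v⁻¹ * u)) (add_mem (hd (hι h)) (hι (hd h))) using 1
    have hhom := interiorProduct_twistedD_add_twistedD_interiorProduct hV hF hVF γ
    rw [twistedD_eq_smul_add_smul, twistedD_eq_smul_add_smul hF u v γ]
    simp only [LinearMap.smul_apply, map_add, map_smul, smul_add, smul_smul, mul_inv_cancel₀ hv]
    nth_rw 1 [← hhom]
    module

/-- If `P` is empty, the conditions on the poles do not depend on `μ`, and zero is a homotopy. -/
theorem isPoleHomotopy_zero (hF : ∀ᶠ z in nhdsOff S, AnalyticAt ℂ F z)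
    (hF0 : F ∈ polarFunctions S 0) (u v : ℂ) :
    IsPoleHomotopy (M := fun k => HolForms S k) (twistedD S F hF u v) (logP S 0) fun _ => 0 := by
  have hlogP (a b : ℝ) (k : ℕ) : logP S (0 : Fin n → ℕ) a k = logP S 0 b k := by simp [logP]
  refine ⟨monotone_logP, fun γ h => twistedD_mem_logP hF ?_ u v h, fun γ _ => zero_mem _,
    fun {a} γ h => ?_, fun {a k} γ h => ?_⟩
  · convert hF0 using 2
    ext
    simp
  · rw [hlogP a (a + 1), LinearMap.zero_apply]
    convert h using 1
    exact sub_zero γ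
  · rw [hlogP a (a + 1), LinearMap.zero_apply, LinearMap.zero_apply, map_zero]
    convert h using 1
    exact (sub_zero _).trans (sub_zero γ)

theorem kontsevich_eq_largestSubcomplex (hF : ∀ᶠ z in nhdsOff S, AnalyticAt ℂ F z) (u : ℂ) {v : ℂ}
    (hv : v ≠ 0) (μ : ℝ) :
    kontsevich S e F hF μ =
      largestSubcomplex (M := fun k => HolForms S k) (twistedD S F hF u v) (logP S e μ) := by
  ext k γ
  refine and_congr_right fun hγ => ?_
  change twistedD S F hF 0 1 k γ ∈ logP S e μ (k + 1) ↔
    twistedD S F hF u v k γ ∈ logP S e μ (k + 1)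
  have hd : u • twistedD S F hF 1 0 k γ ∈ logP S e μ (k + 1) :=
    Submodule.smul_mem _ u (extDeriv_mem_logForms hF hγ)
  rw [twistedD_eq_smul_add_smul hF u v]
  refine ⟨fun h => add_mem hd (Submodule.smul_mem _ v h), fun h => ?_⟩
  refine (Submodule.smul_mem_iff _ hv).1 ?_
  convert add_mem h (Submodule.smul_mem _ (-1) hd) using 1
  module

theorem sigma_eq_stupidTruncation (hF : ∀ᶠ z in nhdsOff S, AnalyticAt ℂ F z) (μ : ℝ) :
    sigma S e F hF μ = stupidTruncation (M := fun k => HolForms S k) (kontsevich S e F hF μ) :=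
  rfl

theorem tau_eq_poleFiltration (μ : ℝ) :
    tau S e μ =
      poleFiltration (M := fun k => HolForms S k) (logP S e) fun p => μ - (max p 0 : ℤ) := by
  ext p k : 2
  simp only [tau, F0, poleFiltration, stupidTruncation]
  split_ifs with h₀ h₁ h₂
  · rw [max_eq_right h₀, sub_neg_eq_add, Int.cast_zero, sub_zero]
  · lia
  · rw [max_eq_left (by lia)]
    congr 1
    ring
  · rfl

theorem FYu_eq (lam : ℝ) (k : ℕ) :
    FYu S e lam k = if lam ≤ k then logP S e (k - lam) k else ⊥ := by
  simp only [FYu, logPPlus, sub_nonneg]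

theorem neg_add_intCast_le_natCast_iff {α : ℝ} (hα : 0 ≤ α) (hα' : α < 1) (p : ℤ) (k : ℕ) :
    -α + p ≤ k ↔ p ≤ k := by
  constructor
  · intro h
    have : (p : ℝ) < (k + 1 : ℤ) := by push_cast; linarith
    exact Int.lt_add_one_iff.1 (mod_cast this)
  · intro h
    have : (p : ℝ) ≤ k := mod_cast h
    linarith

theorem irregularHodge_eq_poleFiltration {α : ℝ} (hα : 0 ≤ α) (hα' : α < 1) :
    irregularHodge S e α =
      poleFiltration (M := fun k => HolForms S k) (logP S e) fun p => α - p := by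
  ext p k : 2
  simp only [irregularHodge, poleFiltration, stupidTruncation, FYu_eq,
    neg_add_intCast_le_natCast_iff hα hα']
  congr 2
  ring

theorem truncatedFYu_eq_poleFiltration {α : ℝ} (hα : 0 ≤ α) (hα' : α < 1) :
    truncatedFYu S e α = poleFiltration (M := fun k => HolForms S k) (logP S e)
      fun p => if p ≤ 0 then 0 else α - p := by
  ext p k : 2
  by_cases hp : p ≤ 0
  · have hpk : p ≤ k := by lia
    simp [truncatedFYu, poleFiltration, stupidTruncation, FYu_eq, hp, hpk]
  · have hirr := congrFun₂ (irregularHodge_eq_poleFiltration (S := S) (e := e) hα hα') p k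
    simpa only [truncatedFYu, hp, if_false, poleFiltration, irregularHodge] using hirr

end LogP

/-! ### Forms with arbitrary poles -/

section MeroForms

variable {n : ℕ} {S : Finset (Fin n)} {m : Fin n → ℤ} {k : ℕ} {F : (Fin n → ℂ) → ℂ}

theorem prod_mem_polarFunctions {ι : Type*} {s : Finset ι} {m : ι → Fin n → ℤ}
    {b : ι → (Fin n → ℂ) → ℂ} (h : ∀ a ∈ s, b a ∈ polarFunctions S (m a)) :
    ∏ a ∈ s, b a ∈ polarFunctions S (∑ a ∈ s, m a) := by
  classical
  induction s using Finset.induction_on with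
  | empty => exact mem_polarFunctions_zero analyticAt_const
  | insert a s ha ih =>
    rw [Finset.prod_insert ha, Finset.sum_insert ha]
    exact mul_mem_polarFunctions (h a (Finset.mem_insert_self a s))
      (ih fun b hb => h b (Finset.mem_insert_of_mem hb))

theorem laurentMonomial_natCast (N : ℕ) (z : Fin n → ℂ) :
    laurentMonomial S (fun _ => (N : ℤ)) z = (∏ i ∈ S, z i) ^ N := by
  simp [laurentMonomial, Finset.prod_pow]

variable (S) in
/-- The factor by which `logFrame S z i` differs from the `i`-th vector of the standard basis. -/
def logScale (i : Fin n) (z : Fin n → ℂ) : ℂ := if i ∈ S then z i else 1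

theorem logScale_ne_zero {z : Fin n → ℂ} (hz : z ∈ offHyperplanes S) (i : Fin n) :
    logScale S i z ≠ 0 := by
  unfold logScale
  split_ifs with hi
  exacts [hz i hi, one_ne_zero]

theorem logScale_mem_polarFunctions (i : Fin n) : logScale S i ∈ polarFunctions S 0 := by
  refine mem_polarFunctions_zero ?_
  unfold logScale
  split_ifs
  exacts [analyticAt_coord i 0, analyticAt_const]

theorem inv_logScale_mem_polarFunctions (i : Fin n) :
    (logScale S i)⁻¹ ∈ polarFunctions S 1 := by
  refine ⟨laurentMonomial S (1 - Pi.single i 1), analyticAt_laurentMonomial fun j _ => ?_, ?_⟩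
  · obtain rfl | hj := eq_or_ne j i <;> simp [*]
  · filter_upwards [eventually_mem_offHyperplanes] with z hz
    rw [Pi.inv_apply, sub_eq_add_neg, laurentMonomial_add hz, laurentMonomial_neg]
    congr 2
    unfold logScale laurentMonomial
    split_ifs with hi
    · rw [Finset.prod_eq_single_of_mem i hi fun j _ hj => by simp [hj]]
      simp
    · exact (Finset.prod_eq_one fun j hj => by simp [ne_of_mem_of_not_mem hj hi]).symm

theorem apply_logFrame (w : Form n k) (J : Fin k → Fin n) (z : Fin n → ℂ) :
    w (fun a => logFrame S z (J a)) =
      (∏ a, logScale S (J a) z) * w fun a => Pi.single (J a) 1 := by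
  have h : (fun a => logFrame S z (J a)) =
      fun a => logScale S (J a) z • (Pi.single (J a) 1 : Fin n → ℂ) := by
    ext a : 1
    rw [logFrame, ← Pi.single_smul, smul_eq_mul, mul_one, logScale]
  rw [h]
  exact w.toMultilinearMap.map_smul_univ _ _

variable (n k) in
/-- The coefficients of a form in the standard basis. -/
def formCoefficients : Form n k →L[ℂ] (Fin k → Fin n) → ℂ :=
  ContinuousLinearMap.pi fun J =>
    ContinuousAlternatingMap.apply ℂ (Fin n → ℂ) ℂ fun a => Pi.single (J a) 1

theorem formCoefficients_apply (w : Form n k) (J : Fin k → Fin n) :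
    formCoefficients n k w J = w fun a => Pi.single (J a) 1 := rfl

theorem ker_formCoefficients : (formCoefficients n k).toLinearMap.ker = ⊥ := by
  refine LinearMap.ker_eq_bot'.2 fun w hw => ContinuousAlternatingMap.toAlternatingMap_injective ?_
  refine Module.Basis.ext_alternating (Pi.basisFun ℂ (Fin n)) fun J _ => ?_
  simpa [formCoefficients_apply] using congrFun hw J

theorem mem_meroForms_iff {γ : HolForms S k} {η : (Fin n → ℂ) → Form n k}
    (h : (η : Germ (nhdsOff S) (Form n k)) = γ.1) :
    γ ∈ meroForms S k ↔ ∃ N : ℕ, ∀ J : Fin k → Fin n,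
      (fun z => formCoefficients n k (η z) J) ∈ polarFunctions S fun _ => (N : ℤ) := by
  constructor
  · rintro ⟨η', hη', N, θ, hθ, hηθ⟩
    refine ⟨N, fun J => ⟨fun z => formCoefficients n k (θ z) J, ?_, ?_⟩⟩
    · exact analyticAt_pi_iff.1 (((formCoefficients n k).analyticAt _).comp hθ) J
    · filter_upwards [hηθ, Germ.coe_eq.1 (hη'.trans h.symm)] with z hz hz'
      rw [← hz, map_smul, laurentMonomial_natCast, hz']
      rfl
  · rintro ⟨N, hN⟩
    choose c hc hηc using hN
    obtain ⟨Ψ, hΨ⟩ :=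
      LinearMap.exists_leftInverse_of_injective _ ker_formCoefficients
    refine ⟨η, h, N, fun z => Ψ fun J => c J z, ?_, ?_⟩
    · exact (Ψ.toContinuousLinearMap.analyticAt _).comp (f := fun z J => c J z)
        (x := (0 : Fin n → ℂ)) (AnalyticAt.pi hc)
    · filter_upwards [eventually_all.2 hηc] with z hz
      have hz' : (fun J => c J z) = formCoefficients n k ((∏ i ∈ S, z i) ^ N • η z) := by
        ext J
        rw [← hz J, laurentMonomial_natCast, map_smul, Pi.smul_apply, smul_eq_mul]
      rw [hz']
      exact (LinearMap.congr_fun hΨ _).symm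

theorem exists_mem_logForms_of_mem_meroForms {γ : HolForms S k} (h : γ ∈ meroForms S k) :
    ∃ m, γ ∈ logForms S m k := by
  obtain ⟨η, hη, -⟩ := γ.2
  obtain ⟨N, hN⟩ := (mem_meroForms_iff hη).1 h
  refine ⟨∑ _a : Fin k, 0 + fun _ => (N : ℤ), (mem_logForms_iff hη).2 fun J => ?_⟩
  convert mul_mem_polarFunctions
    (prod_mem_polarFunctions fun a (_ : a ∈ Finset.univ) => logScale_mem_polarFunctions (J a))
    (hN J) using 1
  ext z
  simp [apply_logFrame, formCoefficients_apply]

theorem logForms_le_meroForms : logForms S m k ≤ meroForms S k := by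
  intro γ h
  obtain ⟨η, hη, -⟩ := γ.2
  refine (mem_meroForms_iff hη).2 ⟨k + ∑ i, (m i).toNat, fun J => ?_⟩
  have hmem : ((∏ a, (logScale S (J a))⁻¹) * fun z => η z fun a => logFrame S z (J a)) ∈
      polarFunctions S (∑ _a : Fin k, 1 + m) :=
    mul_mem_polarFunctions (prod_mem_polarFunctions fun a _ => inv_logScale_mem_polarFunctions _)
      ((mem_logForms_iff hη).1 h J)
  refine polarFunctions_mono (fun i _ => ?_) ((mem_polarFunctions_congr ?_).1 hmem)
  · have hi : (m i).toNat ≤ ∑ i, (m i).toNat :=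
      Finset.single_le_sum (f := fun i => (m i).toNat) (fun _ _ => Nat.zero_le _)
        (Finset.mem_univ i)
    have := Int.self_le_toNat (m i)
    simp only [Finset.sum_const, Finset.card_univ, Fintype.card_fin, Pi.add_apply, nsmul_eq_mul,
      Pi.mul_apply, Pi.natCast_apply, Pi.one_apply]
    lia
  · filter_upwards [eventually_mem_offHyperplanes] with z hz
    have hne : ∏ a, logScale S (J a) z ≠ 0 :=
      Finset.prod_ne_zero_iff.2 fun a _ => logScale_ne_zero hz (J a)
    simp [apply_logFrame, formCoefficients_apply, hne]

theorem isSubcomplex_meroForms (hF : ∀ᶠ z in nhdsOff S, AnalyticAt ℂ F z)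
    (hFm : F ∈ polarFunctions S m) (u v : ℂ) :
    IsSubcomplex (M := fun k => HolForms S k) (twistedD S F hF u v) (meroForms S) := by
  intro k γ h
  obtain ⟨m', hγ⟩ := exists_mem_logForms_of_mem_meroForms h
  rw [twistedD_eq_smul_add_smul]
  exact add_mem
    (Submodule.smul_mem _ _ (logForms_le_meroForms (extDeriv_mem_logForms hF hγ)))
    (Submodule.smul_mem _ _ (logForms_le_meroForms (dF_mem_logForms hF hFm hγ)))

theorem irregularHodge_le_meroForms (e : Fin n → ℕ) (α : ℝ) (p : ℤ) :
    irregularHodge S e α p k ≤ meroForms S k := by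
  rw [irregularHodge, FYu_eq]
  split_ifs
  exacts [logForms_le_meroForms, bot_le]

end MeroForms

/-! ### Averages of holomorphic functions -/

section Average

variable {E G : Type*} [NormedAddCommGroup E] [NormedSpace ℂ E] [NormedAddCommGroup G]
  [NormedSpace ℂ G] {g : E → G} {p : FormalMultilinearSeries ℂ E G} {L : ℝ → E →L[ℂ] E}

/-- The power series at the origin of `z ↦ ∫ t in 0..1, g (L t z)`, where `p` is the power series
of `g` and the `L t` are linear maps. -/
def averageSeries (p : FormalMultilinearSeries ℂ E G) (L : ℝ → E →L[ℂ] E) :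
    FormalMultilinearSeries ℂ E G :=
  fun k => ∫ t in (0 : ℝ)..1, (p k).compContinuousLinearMap fun _ => L t

theorem averageSeries_apply [CompleteSpace G] (hL : Continuous L) (k : ℕ) (y : E) :
    averageSeries p L k (fun _ => y) = ∫ t in (0 : ℝ)..1, p k fun _ => L t y := by
  have hcont : Continuous fun t => (p k).compContinuousLinearMap fun _ => L t :=
    (ContinuousMultilinearMap.compContinuousLinearMapLRight (p k)).cont.comp
      (continuous_pi fun _ => hL)
  exact ((ContinuousMultilinearMap.apply ℂ (fun _ : Fin k => E) G
    fun _ => y).intervalIntegral_comp_comm (hcont.intervalIntegrable 0 1)).symm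

theorem norm_averageSeries_le (hL : ∀ t ∈ Set.Icc (0 : ℝ) 1, ‖L t‖ ≤ 1) (k : ℕ) :
    ‖averageSeries p L k‖ ≤ ‖p k‖ := by
  have h := intervalIntegral.norm_integral_le_of_norm_le_const (C := ‖p k‖)
    (f := fun t => (p k).compContinuousLinearMap fun _ => L t) (a := 0) (b := 1) fun t ht => by
      rw [Set.uIoc_of_le zero_le_one] at ht
      refine (ContinuousMultilinearMap.norm_compContinuousLinearMap_le _ _).trans
        (mul_le_of_le_one_right (norm_nonneg _) ?_)
      exact Finset.prod_le_one (fun _ _ => norm_nonneg _) fun _ _ => hL t ⟨ht.1.le, ht.2⟩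
  simpa [averageSeries] using h

theorem hasFPowerSeriesOnBall_average [CompleteSpace G] {r : ENNReal}
    (hg : HasFPowerSeriesOnBall g p 0 r) (hL : Continuous L)
    (hL1 : ∀ t ∈ Set.Icc (0 : ℝ) 1, ‖L t‖ ≤ 1) :
    HasFPowerSeriesOnBall (fun z => ∫ t in (0 : ℝ)..1, g (L t z)) (averageSeries p L) 0 r := by
  refine ⟨hg.r_le.trans (FormalMultilinearSeries.radius_le_of_le (norm_averageSeries_le hL1)),
    hg.r_pos, fun {y} hy => ?_⟩
  have hyr : (‖y‖₊ : ENNReal) < r := by simpa [enorm] using hy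
  have hLy : ∀ t ∈ Set.uIoc (0 : ℝ) 1, ‖L t y‖ ≤ ‖y‖ := fun t ht => by
    rw [Set.uIoc_of_le zero_le_one] at ht
    exact ((L t).le_of_opNorm_le (hL1 t ⟨ht.1.le, ht.2⟩) y).trans_eq (one_mul _)
  have hmeas : ∀ k, Continuous fun t => p k fun _ => L t y := fun k =>
    (p k).cont.comp (continuous_pi fun _ => hL.clm_apply continuous_const)
  have hbound : ∀ k, ∀ t ∈ Set.uIoc (0 : ℝ) 1, ‖p k fun _ => L t y‖ ≤ ‖p k‖ * ‖y‖ ^ k :=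
    fun k t ht => by simpa using (p k).le_opNorm_mul_prod_of_le fun _ => hLy t ht
  have hsummable : Summable fun k => ‖p k‖ * ‖y‖ ^ k := by
    simpa only [coe_nnnorm] using p.summable_norm_mul_pow (hyr.trans_le hg.r_le)
  have hsum : ∀ t ∈ Set.uIoc (0 : ℝ) 1, HasSum (fun k => p k fun _ => L t y) (g (L t y)) :=
    fun t ht => by
      have hLyr : L t y ∈ Metric.eball (0 : E) r := by
        refine lt_of_le_of_lt ?_ hyr
        simpa [enorm, ← NNReal.coe_le_coe] using hLy t ht
      simpa using hg.hasSum hLyr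
  simp only [averageSeries_apply hL, zero_add]
  exact intervalIntegral.hasSum_integral_of_dominated_convergence (fun k _ => ‖p k‖ * ‖y‖ ^ k)
    (fun k => (hmeas k).aestronglyMeasurable) (fun k => .of_forall (hbound k))
    (.of_forall fun _ _ => hsummable) intervalIntegrable_const (.of_forall hsum)

theorem analyticAt_average [CompleteSpace G] (hg : AnalyticAt ℂ g 0) (hL : Continuous L)
    (hL1 : ∀ t ∈ Set.Icc (0 : ℝ) 1, ‖L t‖ ≤ 1) :
    AnalyticAt ℂ (fun z => ∫ t in (0 : ℝ)..1, g (L t z)) 0 := by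
  obtain ⟨p, r, hp⟩ := hg
  exact ⟨_, r, hasFPowerSeriesOnBall_average hp hL hL1⟩

end Average

/-! ### Division by a coordinate -/

section Division

variable {n : ℕ} {h : (Fin n → ℂ) → ℂ}

/-- The linear map multiplying the `i`-th coordinate by `t`. -/
def scaleCoord (i : Fin n) (t : ℝ) : (Fin n → ℂ) →L[ℂ] (Fin n → ℂ) :=
  ContinuousLinearMap.id ℂ _ - (1 - (t : ℂ)) •
    (ContinuousLinearMap.single ℂ (fun _ : Fin n => ℂ) i).comp (ContinuousLinearMap.proj i)

theorem scaleCoord_apply (i : Fin n) (t : ℝ) (z : Fin n → ℂ) :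
    scaleCoord i t z = Function.update z i (t * z i) := by
  ext j
  rcases eq_or_ne j i with rfl | hj
  · simp [scaleCoord, sub_mul]
  · simp [scaleCoord, hj]

theorem continuous_scaleCoord (i : Fin n) : Continuous (scaleCoord i) :=
  continuous_const.sub ((continuous_const.sub Complex.continuous_ofReal).smul continuous_const)

theorem norm_scaleCoord_le (i : Fin n) {t : ℝ} (ht : t ∈ Set.Icc (0 : ℝ) 1) :
    ‖scaleCoord i t‖ ≤ 1 := by
  refine ContinuousLinearMap.opNorm_le_bound _ zero_le_one fun z => ?_
  rw [one_mul, scaleCoord_apply, pi_norm_le_iff_of_nonneg (norm_nonneg _)]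
  intro j
  rcases eq_or_ne j i with rfl | hj
  · rw [Function.update_self, norm_mul, Complex.norm_real, Real.norm_of_nonneg ht.1]
    exact (mul_le_of_le_one_left (norm_nonneg _) ht.2).trans (norm_le_pi_norm z j)
  · rw [Function.update_of_ne hj]
    exact norm_le_pi_norm z j

theorem scaleCoord_mem_ball (i : Fin n) {t r : ℝ} (ht : t ∈ Set.Icc (0 : ℝ) 1) {z : Fin n → ℂ}
    (hz : z ∈ Metric.ball (0 : Fin n → ℂ) r) : scaleCoord i t z ∈ Metric.ball 0 r := by
  rw [mem_ball_zero_iff] at hz ⊢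
  exact ((scaleCoord i t).le_of_opNorm_le (norm_scaleCoord_le i ht) z).trans_lt (by rwa [one_mul])

theorem hasDerivAt_comp_scaleCoord {i : Fin n} {t : ℝ} {z : Fin n → ℂ}
    (hh : DifferentiableAt ℂ h (scaleCoord i t z)) :
    HasDerivAt (fun s : ℝ => h (scaleCoord i s z))
      (z i * fderiv ℂ h (scaleCoord i t z) (Pi.single i 1)) t := by
  simp only [scaleCoord_apply] at hh ⊢
  have hline : HasDerivAt (fun s : ℂ => s * z i) (z i) t := by
    simpa using (hasDerivAt_id (t : ℂ)).mul_const (z i)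
  have hupdate := hh.hasFDerivAt.comp_hasDerivAt (t * z i) (hasDerivAt_update z i (t * z i))
  exact (hupdate.comp (t : ℂ) hline).comp_ofReal.congr_deriv (mul_comm _ _)

theorem exists_eq_coord_mul (hh : AnalyticAt ℂ h 0) (i : Fin n)
    (h0 : ∀ᶠ z in 𝓝 (0 : Fin n → ℂ), z i = 0 → h z = 0) :
    ∃ h' : (Fin n → ℂ) → ℂ, AnalyticAt ℂ h' 0 ∧ ∀ᶠ z in 𝓝 0, h z = z i * h' z := by
  -- The quotient is the average of `∂h/∂z_i` along the segment from `z_i = 0` to `z`.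
  let g : (Fin n → ℂ) → ℂ := fun z => fderiv ℂ h z (Pi.single i 1)
  have hg : ∀ {z}, AnalyticAt ℂ h z → AnalyticAt ℂ g z := fun hz =>
    analyticAt_clm_apply hz.fderiv analyticAt_const
  refine ⟨_, analyticAt_average (hg hh) (continuous_scaleCoord i)
    fun t ht => norm_scaleCoord_le i ht, ?_⟩
  obtain ⟨r, hr, hball⟩ := Metric.eventually_nhds_iff_ball.1 (h0.and hh.eventually_analyticAt)
  filter_upwards [Metric.ball_mem_nhds 0 hr] with z hz
  have han : ∀ t ∈ Set.uIcc (0 : ℝ) 1, AnalyticAt ℂ h (scaleCoord i t z) := fun t ht =>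
    (hball _ (scaleCoord_mem_ball i (Set.uIcc_of_le (zero_le_one' ℝ) ▸ ht) hz)).2
  have hpath : Continuous fun t => scaleCoord i t z :=
    (continuous_scaleCoord i).clm_apply continuous_const
  have hcont : ContinuousOn (fun t : ℝ => z i * g (scaleCoord i t z)) (Set.uIcc 0 1) :=
    continuousOn_const.mul fun t ht => (ContinuousAt.comp (f := fun t => scaleCoord i t z)
      (hg (han t ht)).continuousAt hpath.continuousAt).continuousWithinAt
  have hint := intervalIntegral.integral_eq_sub_of_hasDerivAt
    (fun t ht => hasDerivAt_comp_scaleCoord (han t ht).differentiableAt) hcont.intervalIntegrable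
  have hz0 : h (scaleCoord i 0 z) = 0 :=
    (hball _ (scaleCoord_mem_ball i (by simp) hz)).1 (by simp [scaleCoord_apply])
  have hz1 : scaleCoord i 1 z = z := by simp [scaleCoord_apply]
  rw [hz0, hz1, sub_zero, intervalIntegral.integral_const_mul] at hint
  exact hint.symm

end Division

/-! ### Holomorphic germs vanishing only on coordinate hyperplanes -/

theorem eventually_exists_mem_closedBall_eq_zero {W : Type*} [TopologicalSpace W]
    {Φ : W → ℂ → ℂ} {w₀ : W} {a : ℂ} {ρ : ℝ} (hρ : 0 < ρ)
    (hcont : ∀ ζ ∈ Metric.closedBall a ρ, ContinuousAt (fun p : W × ℂ => Φ p.1 p.2) (w₀, ζ))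
    (hdiff : ∀ᶠ w in 𝓝 w₀, DifferentiableOn ℂ (Φ w) (Metric.closedBall a ρ))
    (ha : Φ w₀ a = 0) (hne : ∀ ζ ∈ Metric.sphere a ρ, Φ w₀ ζ ≠ 0) :
    ∀ᶠ w in 𝓝 w₀, ∃ ζ ∈ Metric.closedBall a ρ, Φ w ζ = 0 := by
  have hcont₀ : ∀ ζ ∈ Metric.closedBall a ρ, ContinuousAt (Φ w₀) ζ := fun ζ hζ =>
    ContinuousAt.comp (f := fun ζ : ℂ => (w₀, ζ)) (hcont ζ hζ) (by fun_prop)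
  obtain ⟨ζ₀, hζ₀, hmin⟩ := (isCompact_sphere a ρ).exists_isMinOn
    (NormedSpace.sphere_nonempty.2 hρ.le) (f := fun ζ => ‖Φ w₀ ζ‖) fun ζ hζ =>
      (hcont₀ ζ (Metric.sphere_subset_closedBall hζ)).norm.continuousWithinAt
  obtain ⟨δ, hδ0, hδ⟩ := exists_between (norm_pos_iff.2 (hne ζ₀ hζ₀))
  have hsphere : ∀ᶠ w in 𝓝 w₀, ∀ ζ ∈ Metric.sphere a ρ, δ < ‖Φ w ζ‖ :=
    (isCompact_sphere a ρ).eventually_forall_of_forall_eventually fun ζ hζ =>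
      (hcont ζ (Metric.sphere_subset_closedBall hζ)).norm.eventually
        (lt_mem_nhds (hδ.trans_le (hmin hζ)))
  have hcentre : ∀ᶠ w in 𝓝 w₀, ‖Φ w a‖ < δ := by
    have hcont_a : ContinuousAt (fun w => ‖Φ w a‖) w₀ :=
      (ContinuousAt.comp (f := fun w : W => (w, a))
        (hcont a (Metric.mem_closedBall_self hρ.le)) (by fun_prop)).norm
    exact hcont_a.eventually (gt_mem_nhds (by simpa only [ha, norm_zero] using hδ0))
  filter_upwards [hdiff, hsphere, hcentre] with w hw hwsphere hwcentre
  -- Otherwise the maximum principle for `1 / Φ w` is violated.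
  by_contra! hnz
  have hmax := Complex.norm_le_of_forall_mem_frontier_norm_le (C := δ⁻¹) Metric.isBounded_ball
    (DifferentiableOn.diffContOnCl_ball (hw.inv hnz) subset_rfl)
    (fun ζ hζ => by
      rw [frontier_ball _ hρ.ne'] at hζ
      rw [Pi.inv_apply, norm_inv]
      exact inv_anti₀ hδ0 (hwsphere ζ hζ).le)
    (subset_closure (Metric.mem_ball_self hρ))
  rw [Pi.inv_apply, norm_inv, inv_le_inv₀ (norm_pos_iff.2
    (hnz a (Metric.mem_closedBall_self hρ.le))) hδ0] at hmax
  exact hwcentre.not_ge hmax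

section UnitMonomial

variable {n : ℕ} {S : Finset (Fin n)} {g h : (Fin n → ℂ) → ℂ} {i : Fin n}

theorem analyticOrderAt_diagonal_ne_top (hg0 : ∀ᶠ z in nhdsOff S, g z ≠ 0) :
    analyticOrderAt (fun t : ℂ => g fun _ => t) 0 ≠ ⊤ := by
  rw [Ne, analyticOrderAt_eq_top]
  intro hzero
  have htend : Tendsto (fun (t : ℂ) (_ : Fin n) => t) (𝓝[≠] 0) (nhdsOff S) := by
    refine tendsto_nhdsWithin_iff.2 ⟨?_, ?_⟩
    · exact (Continuous.tendsto (by fun_prop) 0).mono_left nhdsWithin_le_nhds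
    · filter_upwards [self_mem_nhdsWithin] with t ht j _ using ht
  obtain ⟨t, ht, ht'⟩ :=
    ((htend.eventually hg0).and (hzero.filter_mono nhdsWithin_le_nhds)).exists
  exact ht ht'

theorem exists_maximal_coord_pow (hg : AnalyticAt ℂ g 0)
    (hg0 : ∀ᶠ z in nhdsOff S, g z ≠ 0) (i : Fin n) :
    ∃ (m : ℕ) (h : (Fin n → ℂ) → ℂ), AnalyticAt ℂ h 0 ∧ (∀ᶠ z in 𝓝 0, g z = z i ^ m * h z) ∧
      ¬ ∀ᶠ z in 𝓝 (0 : Fin n → ℂ), z i = 0 → h z = 0 := by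
  by_contra! H
  have hdiv : ∀ m : ℕ, ∃ h : (Fin n → ℂ) → ℂ, AnalyticAt ℂ h 0 ∧
      ∀ᶠ z in 𝓝 0, g z = z i ^ m * h z := by
    intro m
    induction m with
    | zero => exact ⟨g, hg, by simp⟩
    | succ m ih =>
      obtain ⟨h, hh, hgh⟩ := ih
      obtain ⟨h', hh', hhh⟩ := exists_eq_coord_mul hh i (H m h hh hgh)
      refine ⟨h', hh', ?_⟩
      filter_upwards [hgh, hhh] with z h1 h2
      rw [h1, h2, pow_succ, mul_assoc]
  have hdiag : Tendsto (fun (t : ℂ) (_ : Fin n) => t) (𝓝 0) (𝓝 0) :=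
    Continuous.tendsto (by fun_prop) 0
  have han {h : (Fin n → ℂ) → ℂ} (hh : AnalyticAt ℂ h 0) :
      AnalyticAt ℂ (fun t : ℂ => h fun _ => t) 0 :=
    AnalyticAt.comp (f := fun (t : ℂ) (_ : Fin n) => t) hh
      (analyticAt_pi_iff.2 fun _ => analyticAt_id)
  refine analyticOrderAt_diagonal_ne_top hg0 (ENat.eq_top_iff_forall_ge.2 fun m => ?_)
  obtain ⟨h, hh, hgh⟩ := hdiv m
  refine (natCast_le_analyticOrderAt (han hg)).2 ⟨_, han hh, ?_⟩
  filter_upwards [hdiag.eventually hgh] with t ht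
  simpa using ht

theorem update_mem_ball {r : ℝ} {z : Fin n → ℂ} (hz : z ∈ Metric.ball (0 : Fin n → ℂ) r)
    (i : Fin n) {ζ : ℂ} (hζ : ‖ζ‖ < r) : Function.update z i ζ ∈ Metric.ball 0 r := by
  rw [mem_ball_zero_iff] at hz ⊢
  have hr : 0 < r := (norm_nonneg _).trans_lt hz
  rw [pi_norm_lt_iff hr] at hz ⊢
  intro j
  rcases eq_or_ne j i with rfl | hj
  · simpa using hζ
  · simpa [hj] using hz j

theorem update_mem_offHyperplanes (hi : i ∉ S) {z : Fin n → ℂ} (hz : z ∈ offHyperplanes S)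
    (ζ : ℂ) : Function.update z i ζ ∈ offHyperplanes S := fun j hj => by
  rw [Function.update_of_ne (ne_of_mem_of_not_mem hj hi)]
  exact hz j hj

theorem eventually_eq_zero_of_eventually_update_eq_zero {r : ℝ}
    (han : ∀ z ∈ Metric.ball (0 : Fin n → ℂ) r, AnalyticAt ℂ h z) {z : Fin n → ℂ}
    (hz : z ∈ Metric.ball (0 : Fin n → ℂ) r)
    (hzero : ∀ᶠ w in 𝓝 z, h (Function.update w i 0) = 0) :
    ∀ᶠ w in 𝓝 (0 : Fin n → ℂ), w i = 0 → h w = 0 := by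
  have hr : 0 < r := Metric.pos_of_mem_ball hz
  have hupdate : (fun w => h (Function.update w i 0)) = fun w => h (scaleCoord i 0 w) := by
    simp [scaleCoord_apply]
  have han' : AnalyticOnNhd ℂ (fun w => h (Function.update w i 0)) (Metric.ball 0 r) := by
    intro w hw
    rw [hupdate]
    exact AnalyticAt.comp (han _ (scaleCoord_mem_ball i (by simp) hw))
      ((scaleCoord i 0).analyticAt w)
  have hzero' := han'.eqOn_zero_of_preconnected_of_eventuallyEq_zero
    (convex_ball _ _).isPreconnected hz hzero
  filter_upwards [Metric.ball_mem_nhds 0 hr] with w hw hwi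
  have hw' : h (Function.update w i 0) = 0 := hzero' hw
  rwa [Function.update_eq_self_iff.2 hwi.symm] at hw'

theorem ne_zero_of_ne_zero_off_insert (hi : i ∉ S) {r : ℝ}
    (han : ∀ z ∈ Metric.ball (0 : Fin n → ℂ) r, AnalyticAt ℂ h z)
    (hne : ∀ z ∈ Metric.ball (0 : Fin n → ℂ) r, z ∈ offHyperplanes S → z i ≠ 0 → h z ≠ 0)
    (hi0 : ¬ ∀ᶠ z in 𝓝 (0 : Fin n → ℂ), z i = 0 → h z = 0) {z : Fin n → ℂ}
    (hz : z ∈ Metric.ball (0 : Fin n → ℂ) r) (hzS : z ∈ offHyperplanes S) : h z ≠ 0 := by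
  by_cases hzi : z i ≠ 0
  · exact hne z hz hzS hzi
  push Not at hzi
  intro hhz
  obtain ⟨ρ, hρ0, hρr⟩ := exists_between (Metric.pos_of_mem_ball hz)
  have hlt : ∀ ζ ∈ Metric.closedBall (0 : ℂ) ρ, ‖ζ‖ < r := fun ζ hζ =>
    (mem_closedBall_zero_iff.1 hζ).trans_lt hρr
  have hnear : ∀ᶠ w in 𝓝 z, w ∈ Metric.ball 0 r ∧ w ∈ offHyperplanes S :=
    (Metric.isOpen_ball.eventually_mem hz).and ((isOpen_offHyperplanes S).eventually_mem hzS)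
  -- A zero at `z` would persist nearby, and on the hyperplane `z_i = 0`, so `h` would vanish there.
  have hroot : ∀ᶠ w in 𝓝 z, ∃ ζ ∈ Metric.closedBall (0 : ℂ) ρ, h (Function.update w i ζ) = 0 := by
    refine eventually_exists_mem_closedBall_eq_zero hρ0 (fun ζ hζ => ?_) ?_ ?_ fun ζ hζ => ?_
    · have hcont : Continuous fun p : (Fin n → ℂ) × ℂ => Function.update p.1 i p.2 :=
        continuous_fst.update i continuous_snd
      exact ContinuousAt.comp (f := fun p : (Fin n → ℂ) × ℂ => Function.update p.1 i p.2)
        (han _ (update_mem_ball hz i (hlt ζ hζ))).continuousAt hcont.continuousAt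
    · filter_upwards [hnear] with w hw ζ hζ
      exact ((han _ (update_mem_ball hw.1 i (hlt ζ hζ))).differentiableAt.comp ζ
        (hasDerivAt_update w i ζ).differentiableAt).differentiableWithinAt
    · rwa [Function.update_eq_self_iff.2 hzi.symm]
    · exact hne _ (update_mem_ball hz i (hlt ζ (Metric.sphere_subset_closedBall hζ)))
        (update_mem_offHyperplanes hi hzS ζ)
        (by simpa using Metric.ne_of_mem_sphere hζ hρ0.ne')
  refine hi0 (eventually_eq_zero_of_eventually_update_eq_zero han hz ?_)
  filter_upwards [hroot, hnear] with w ⟨ζ, hζ, hwζ⟩ ⟨hw, hwS⟩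
  rcases eq_or_ne ζ 0 with rfl | hζ0
  · exact hwζ
  · exact absurd hwζ (hne _ (update_mem_ball hw i (hlt ζ hζ)) (update_mem_offHyperplanes hi hwS ζ)
      (by simpa using hζ0))

theorem exists_unit_mul_monomial (S : Finset (Fin n)) (hg : AnalyticAt ℂ g 0)
    (hg0 : ∀ᶠ z in nhdsOff S, g z ≠ 0) :
    ∃ (e : Fin n → ℕ) (w : (Fin n → ℂ) → ℂ), AnalyticAt ℂ w 0 ∧ w 0 ≠ 0 ∧
      ∀ᶠ z in 𝓝 0, g z = w z * ∏ i ∈ S, z i ^ e i := by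
  induction S using Finset.induction_on generalizing g with
  | empty =>
    have : nhdsOff (∅ : Finset (Fin n)) = 𝓝 0 := by simp [nhdsOff, offHyperplanes]
    rw [this] at hg0
    exact ⟨0, g, hg, hg0.self_of_nhds, by simp⟩
  | insert i S hi ih =>
    obtain ⟨m, h, hh, hgh, hi0⟩ := exists_maximal_coord_pow hg hg0 i
    obtain ⟨r, hr, hball⟩ := Metric.eventually_nhds_iff_ball.1
      (hgh.and ((eventually_nhdsWithin_iff.1 hg0).and hh.eventually_analyticAt))
    have hne : ∀ᶠ z in nhdsOff S, h z ≠ 0 := by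
      filter_upwards [nhdsOff_le_nhds (Metric.ball_mem_nhds 0 hr), eventually_mem_offHyperplanes]
        with z hz hzS
      refine ne_zero_of_ne_zero_off_insert hi (fun z hz => (hball z hz).2.2)
        (fun z hz hzS hzi hhz => ?_) hi0 hz hzS
      obtain ⟨hgz, hgz0, -⟩ := hball z hz
      exact hgz0 ((Finset.forall_mem_insert _ _ _).2 ⟨hzi, hzS⟩) (by rw [hgz, hhz, mul_zero])
    obtain ⟨e, w, hw, hw0, hhw⟩ := ih hh hne
    refine ⟨Function.update e i m, w, hw, hw0, ?_⟩
    filter_upwards [hgh, hhw] with z hgz hhz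
    have hprod : ∏ j ∈ S, z j ^ Function.update e i m j = ∏ j ∈ S, z j ^ e j :=
      Finset.prod_congr rfl fun j hj => by
        rw [Function.update_of_ne (ne_of_mem_of_not_mem hj hi)]
    rw [hgz, hhz, Finset.prod_insert hi, Function.update_self, hprod]
    ring

theorem tendsto_update_diagonal (i : Fin n) :
    Tendsto (fun t : ℂ => Function.update (fun _ : Fin n => t) i 0) (𝓝[≠] 0) (𝓝 0) := by
  have hcont : Continuous fun t : ℂ => Function.update (fun _ : Fin n => t) i 0 := by fun_prop
  have hzero : Function.update (fun _ : Fin n => (0 : ℂ)) i 0 = 0 := Function.update_eq_self i 0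
  exact hzero ▸ (hcont.tendsto 0).mono_left nhdsWithin_le_nhds

theorem le_of_unit_mul_monomial_eq {e : Fin n → ℕ} {w : (Fin n → ℂ) → ℂ}
    (hw : AnalyticAt ℂ w 0) (hw0 : w 0 ≠ 0) (hg : AnalyticAt ℂ g 0) (hi : i ∈ S)
    {m : ℕ} (h : ∀ᶠ z in 𝓝 (0 : Fin n → ℂ), w z * ∏ j ∈ S, z j ^ e j = z i ^ m * g z) :
    m ≤ e i := by
  -- Compare orders of vanishing along a line which is transversal to `z_i = 0` at a point lying on
  -- no other coordinate hyperplane.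
  obtain ⟨t, ⟨heq, hwt, hgt, hwt0⟩, ht⟩ := (((tendsto_update_diagonal i).eventually
    (h.eventually_nhds.and (hw.eventually_analyticAt.and (hg.eventually_analyticAt.and
      (hw.continuousAt.eventually_ne hw0))))).and self_mem_nhdsWithin).exists
  let line : ℂ → Fin n → ℂ := Function.update (fun _ => t) i
  have hline : AnalyticAt ℂ line 0 := analyticAt_pi_iff.2 fun j => by
    rcases eq_or_ne j i with rfl | hj
    · simpa [line] using! analyticAt_id
    · simpa [line, hj] using analyticAt_const
  have hwl : AnalyticAt ℂ (fun ζ => w (line ζ)) 0 := AnalyticAt.comp hwt hline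
  have hgl : AnalyticAt ℂ (fun ζ => g (line ζ)) 0 := AnalyticAt.comp hgt hline
  let c : ℂ := ∏ j ∈ S.erase i, t ^ e j
  have hc : c ≠ 0 := Finset.prod_ne_zero_iff.2 fun j _ => pow_ne_zero _ ht
  have heql : (fun ζ => ζ ^ e i * (w (line ζ) * c)) =ᶠ[𝓝 0] fun ζ => ζ ^ m * g (line ζ) := by
    filter_upwards [hline.continuousAt.eventually heq] with ζ hζ
    have hprod : ∏ j ∈ S, line ζ j ^ e j = ζ ^ e i * c := by
      rw [← Finset.mul_prod_erase S _ hi]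
      exact congrArg₂ _ (by simp [line]) (Finset.prod_congr rfl fun j hj => by
        simp [line, Finset.ne_of_mem_erase hj])
    rw [hprod] at hζ
    simpa [line, mul_left_comm] using hζ
  have horder : analyticOrderAt (fun ζ => ζ ^ e i * (w (line ζ) * c)) 0 = e i :=
    (AnalyticAt.analyticOrderAt_eq_natCast (by fun_prop)).2
      ⟨fun ζ => w (line ζ) * c, hwl.mul analyticAt_const, mul_ne_zero hwt0 hc,
        .of_forall fun ζ => by rw [sub_zero, smul_eq_mul]⟩
  have hle : (m : ℕ∞) ≤ analyticOrderAt (fun ζ => ζ ^ e i * (w (line ζ) * c)) 0 :=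
    (natCast_le_analyticOrderAt (by fun_prop)).2 ⟨_, hgl, heql.mono fun ζ hζ => by
      rwa [sub_zero, smul_eq_mul]⟩
  exact_mod_cast horder ▸ hle

theorem sSup_coord_pow_dvd {e : Fin n → ℕ} {w : (Fin n → ℂ) → ℂ} (hw : AnalyticAt ℂ w 0)
    (hw0 : w 0 ≠ 0) (hg : ∀ᶠ z in 𝓝 0, g z = w z * ∏ i ∈ S, z i ^ e i) (hi : i ∈ S) :
    sSup {m : ℕ | ∃ h : (Fin n → ℂ) → ℂ, AnalyticAt ℂ h 0 ∧ ∀ᶠ z in 𝓝 0, g z = z i ^ m * h z} =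
      e i := by
  refine IsGreatest.csSup_eq ⟨⟨fun z => w z * ∏ j ∈ S.erase i, z j ^ e j, hw.mul
    (Finset.analyticAt_fun_prod _ fun j _ => (analyticAt_coord j 0).pow _), ?_⟩, ?_⟩
  · filter_upwards [hg] with z hz
    rw [hz, ← Finset.mul_prod_erase S _ hi]
    ring
  · rintro m ⟨h, hh, hgh⟩
    refine le_of_unit_mul_monomial_eq hw hw0 hh hi ?_
    filter_upwards [hg, hgh] with z h1 h2
    rw [← h1, h2]

end UnitMonomial

/-! ### Adapted charts -/

section Chart

variable {n : ℕ} {X : Type*} [TopologicalSpace X] [ChartedSpace (Fin n → ℂ) X]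
  {D : Set X} {x : X} (c : NCChart n D x) {f : X → OnePoint ℂ}

theorem NCChart.zero_mem_target : (0 : Fin n → ℂ) ∈ c.chart.target :=
  c.map_eq_zero ▸ c.chart.map_source c.mem_source

theorem NCChart.symm_zero : c.chart.symm 0 = x := by
  rw [← c.map_eq_zero, c.chart.left_inv c.mem_source]

theorem NCChart.symm_notMem {z : Fin n → ℂ} (hz : z ∈ c.chart.target)
    (hzS : z ∈ offHyperplanes c.S) : c.chart.symm z ∉ D := by
  rw [c.mem_iff _ (c.chart.map_target hz), c.chart.right_inv hz]
  rintro ⟨i, hi, h⟩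
  exact hzS i hi h

theorem NCChart.analyticAt_comp_symm {g : X → ℂ} {z : Fin n → ℂ} (hz : z ∈ c.chart.target)
    (hg : ContMDiffAt 𝓘(ℂ, Fin n → ℂ) 𝓘(ℂ, ℂ) ω g (c.chart.symm z)) :
    AnalyticAt ℂ (fun z => g (c.chart.symm z)) z := by
  have h : ContMDiffAt 𝓘(ℂ, Fin n → ℂ) 𝓘(ℂ, Fin n → ℂ) ω c.chart.symm z :=
    (contMDiffOn_symm_of_mem_maximalAtlas c.mem_maximalAtlas).contMDiffAt
      (c.chart.open_target.mem_nhds hz)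
  exact (hg.comp z h).contDiffAt.analyticAt

theorem NCChart.analyticAt_localF_zero (hf : IsHolomorphicToP1 n f) (hx : f x ≠ OnePoint.infty) :
    AnalyticAt ℂ (c.localF f) 0 :=
  c.analyticAt_comp_symm c.zero_mem_target (hf.contMDiffAt_coordT _ (by rwa [c.symm_zero]))

theorem NCChart.analyticAt_localInvF_zero (hf : IsHolomorphicToP1 n f)
    (hx : f x = OnePoint.infty) : AnalyticAt ℂ (c.localInvF f) 0 :=
  c.analyticAt_comp_symm c.zero_mem_target
    (hf.contMDiffAt_coordT' _ (by rw [c.symm_zero, hx]; exact OnePoint.infty_ne_coe 0))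

theorem coordT_mul_coordT' {q : OnePoint ℂ} (h : q ≠ OnePoint.infty)
    (h0 : q ≠ ((0 : ℂ) : OnePoint ℂ)) : coordT q * coordT' q = 1 := by
  obtain ⟨t, rfl⟩ := OnePoint.ne_infty_iff_exists.1 h
  exact mul_inv_cancel₀ fun ht => h0 (congrArg _ ht)

theorem NCChart.localF_mul_localInvF (hf : IsHolomorphicToP1 n f)
    (hfD : ∀ y, y ∉ D → f y ≠ OnePoint.infty) (hx : f x = OnePoint.infty) :
    ∀ᶠ z in nhdsOff c.S, c.localF f z * c.localInvF f z = 1 := by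
  have hcont : ContinuousAt (fun z => f (c.chart.symm z)) 0 :=
    ContinuousAt.comp (f := c.chart.symm) hf.continuous.continuousAt
      (c.chart.continuousAt_symm c.zero_mem_target)
  have hne : ∀ᶠ z in 𝓝 (0 : Fin n → ℂ), f (c.chart.symm z) ≠ ((0 : ℂ) : OnePoint ℂ) :=
    hcont.eventually_ne (by rw [c.symm_zero, hx]; exact OnePoint.infty_ne_coe 0)
  filter_upwards [nhdsOff_le_nhds hne,
    nhdsOff_le_nhds (c.chart.open_target.mem_nhds c.zero_mem_target),
    eventually_mem_offHyperplanes] with z h0 hz hzS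
  exact coordT_mul_coordT' (hfD _ (c.symm_notMem hz hzS)) h0

theorem NCChart.exists_hasLogPole (hf : IsHolomorphicToP1 n f)
    (hfD : ∀ y, y ∉ D → f y ≠ OnePoint.infty) (hx : f x = OnePoint.infty) :
    ∃ i, HasLogPole c.S (fun j => (c.mult f j : ℤ)) (c.localF f) i := by
  have hmul := c.localF_mul_localInvF hf hfD hx
  obtain ⟨e, w, hw, hw0, hg⟩ := exists_unit_mul_monomial c.S (c.analyticAt_localInvF_zero hf hx)
    (hmul.mono fun z hz h0 => by simp [h0] at hz)
  have hmult : ∀ i ∈ c.S, c.mult f i = e i := fun i hi => by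
    rw [NCChart.mult, if_pos hx]
    exact sSup_coord_pow_dvd hw hw0 hg hi
  obtain ⟨i, hi, hei⟩ : ∃ i ∈ c.S, e i ≠ 0 := by
    by_contra! h
    have h0 : c.localInvF f 0 = 0 := by
      rw [NCChart.localInvF, c.symm_zero, hx]
      rfl
    rw [hg.self_of_nhds, Finset.prod_eq_one fun i hi => by rw [h i hi, pow_zero], mul_one] at h0
    exact hw0 h0
  refine ⟨i, hasLogPole_of_laurentMonomial_mul_eq (hw.inv hw0) (inv_ne_zero hw0) hi
    (by simpa only [hmult i hi, ne_eq, Nat.cast_eq_zero] using hei) ?_⟩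
  filter_upwards [hmul, nhdsOff_le_nhds hg] with z hz hgz
  have hmon : laurentMonomial c.S (fun j => (c.mult f j : ℤ)) z = ∏ i ∈ c.S, z i ^ e i :=
    Finset.prod_congr rfl fun i hi => by simp only [hmult i hi, zpow_natCast]
  rw [hmon]
  refine eq_inv_of_mul_eq_one_left ?_
  rw [← hz, hgz]
  ring

theorem NCChart.mult_eq_zero (hx : f x ≠ OnePoint.infty) : c.mult f = 0 :=
  funext fun _ => if_neg hx

theorem NCChart.exists_isPoleHomotopy (hf : IsHolomorphicToP1 n f)
    (hfD : ∀ y, y ∉ D → f y ≠ OnePoint.infty) (u : ℂ) {v : ℂ} (hv : v ≠ 0) :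
    ∃ h, IsPoleHomotopy (M := fun k => HolForms c.S k) (c.diff f hf hfD u v)
      (logP c.S (c.mult f)) h := by
  by_cases hx : f x = OnePoint.infty
  · obtain ⟨i, hi⟩ := c.exists_hasLogPole hf hfD hx
    exact hi.exists_isPoleHomotopy (c.analyticAt_localF f hf hfD) u hv
  · rw [c.mult_eq_zero hx]
    exact ⟨_, isPoleHomotopy_zero (c.analyticAt_localF f hf hfD)
      (mem_polarFunctions_zero (c.analyticAt_localF_zero hf hx)) u v⟩

theorem NCChart.isSubcomplex_meroForms (hf : IsHolomorphicToP1 n f)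
    (hfD : ∀ y, y ∉ D → f y ≠ OnePoint.infty) (u v : ℂ) :
    IsSubcomplex (M := fun k => HolForms c.S k) (c.diff f hf hfD u v) (meroForms c.S) := by
  by_cases hx : f x = OnePoint.infty
  · obtain ⟨i, hi⟩ := c.exists_hasLogPole hf hfD hx
    exact KontsevichYu.isSubcomplex_meroForms (c.analyticAt_localF f hf hfD)
      hi.mem_polarFunctions u v
  · exact KontsevichYu.isSubcomplex_meroForms (c.analyticAt_localF f hf hfD)
      (mem_polarFunctions_zero (c.analyticAt_localF_zero hf hx)) u v

theorem NCChart.isFilteredQuasiIso_sigma_tau (hf : IsHolomorphicToP1 n f)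
    (hfD : ∀ y, y ∉ D → f y ≠ OnePoint.infty) (u : ℂ) {v : ℂ} (hv : v ≠ 0) (μ : ℝ) :
    c.IsFilteredQuasiIso f hf hfD u v
      (sigma c.S (c.mult f) (c.localF f) (c.analyticAt_localF f hf hfD) μ)
      (tau c.S (c.mult f) μ) := by
  obtain ⟨h, H⟩ := c.exists_isPoleHomotopy hf hfD u hv
  rw [sigma_eq_stupidTruncation, kontsevich_eq_largestSubcomplex _ u hv, tau_eq_poleFiltration]
  refine H.isFilteredQuasiIso_largestSubcomplex (c.diff_diff f hf hfD u v)
    (fun p q hpq => sub_le_sub_left (mod_cast max_le_max_right 0 hpq) μ) (fun p hp => ?_)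
    fun p hp => ?_
  · simp [hp]
  · simp [hp.le]

theorem antitone_ite_zero_sub {α : ℝ} (hα : α < 1) :
    Antitone fun p : ℤ => if p ≤ 0 then 0 else α - p := by
  intro p q hpq
  have hpq' : (p : ℝ) ≤ q := mod_cast hpq
  dsimp only
  split_ifs with hq hp hp
  · rfl
  · lia
  · have : (1 : ℝ) ≤ q := mod_cast not_le.1 hq
    linarith
  · linarith

theorem NCChart.isFilteredQuasiIso_sigma_truncatedFYu (hf : IsHolomorphicToP1 n f)
    (hfD : ∀ y, y ∉ D → f y ≠ OnePoint.infty) (u : ℂ) {v : ℂ} (hv : v ≠ 0) {α : ℝ} (hα : 0 ≤ α)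
    (hα' : α < 1) :
    c.IsFilteredQuasiIso f hf hfD u v
      (sigma c.S (c.mult f) (c.localF f) (c.analyticAt_localF f hf hfD) α)
      (truncatedFYu c.S (c.mult f) α) := by
  obtain ⟨h, H⟩ := c.exists_isPoleHomotopy hf hfD u hv
  rw [sigma_eq_stupidTruncation, kontsevich_eq_largestSubcomplex _ u hv,
    truncatedFYu_eq_poleFiltration hα hα']
  refine H.isFilteredQuasiIso_largestSubcomplex (c.diff_diff f hf hfD u v)
    (antitone_ite_zero_sub hα') (fun p hp => ?_) fun p hp => ?_
  · simp [hp, hα'.le]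
  · simp [hp.not_ge]

theorem NCChart.isFilteredQuasiIso_truncatedFYu_irregularHodge (hf : IsHolomorphicToP1 n f)
    (hfD : ∀ y, y ∉ D → f y ≠ OnePoint.infty) (u : ℂ) {v : ℂ} (hv : v ≠ 0) {α : ℝ} (hα : 0 ≤ α)
    (hα' : α < 1) :
    c.IsFilteredQuasiIso f hf hfD u v (truncatedFYu c.S (c.mult f) α)
      (irregularHodge c.S (c.mult f) α) := by
  obtain ⟨h, H⟩ := c.exists_isPoleHomotopy hf hfD u hv
  rw [truncatedFYu_eq_poleFiltration hα hα', irregularHodge_eq_poleFiltration hα hα']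
  refine H.isFilteredQuasiIso_poleFiltration (c.diff_diff f hf hfD u v)
    (antitone_ite_zero_sub hα')
    (fun p q hpq => sub_le_sub_left (mod_cast hpq) α) (fun p => ?_) fun p hp => if_neg hp.not_ge
  dsimp only
  split_ifs with hp
  · have : (p : ℝ) ≤ 0 := mod_cast hp
    linarith
  · rfl

end Chart

end

end KontsevichYu

theorem mainTheorem11_general {n : ℕ} {X : Type*} [TopologicalSpace X]
    [ChartedSpace (Fin n → ℂ) X] {D : Set X} {x : X} (c : KontsevichYu.NCChart n D x)
    {f : X → OnePoint ℂ} (hf : KontsevichYu.IsHolomorphicToP1 n f)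
    (hfD : ∀ y, y ∉ D → f y ≠ OnePoint.infty) (u : ℂ) {v : ℂ} (hv : v ≠ 0) :
    (∀ μ : ℝ,
      c.IsFilteredQuasiIso f hf hfD u v
        (KontsevichYu.sigma c.S (c.mult f) (c.localF f) (c.analyticAt_localF f hf hfD) μ)
        (KontsevichYu.tau c.S (c.mult f) μ)) ∧
    (∀ α : ℝ, 0 ≤ α → α < 1 →
      c.IsFilteredQuasiIso f hf hfD u v
        (KontsevichYu.sigma c.S (c.mult f) (c.localF f) (c.analyticAt_localF f hf hfD) α)
        (KontsevichYu.truncatedFYu c.S (c.mult f) α) ∧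
      c.IsFilteredQuasiIso f hf hfD u v
        (KontsevichYu.truncatedFYu c.S (c.mult f) α)
        (KontsevichYu.irregularHodge c.S (c.mult f) α) ∧
      KontsevichYu.IsSubcomplex (M := fun k => KontsevichYu.HolForms c.S k)
        (c.diff f hf hfD u v) (KontsevichYu.meroForms c.S) ∧
      ∀ p k, KontsevichYu.irregularHodge c.S (c.mult f) α p k ≤ KontsevichYu.meroForms c.S k) :=
  ⟨fun μ => c.isFilteredQuasiIso_sigma_tau hf hfD u hv μ, fun α hα hα' =>
    ⟨c.isFilteredQuasiIso_sigma_truncatedFYu hf hfD u hv hα hα',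
      c.isFilteredQuasiIso_truncatedFYu_irregularHodge hf hfD u hv hα hα',
      c.isSubcomplex_meroForms hf hfD u v,
      fun p _ => KontsevichYu.irregularHodge_le_meroForms (c.mult f) α p⟩⟩

theorem mainTheorem11 {n : ℕ} {X : Type*} [TopologicalSpace X] [ChartedSpace (Fin n → ℂ) X]
    [IsManifold 𝓘(ℂ, Fin n → ℂ) ω X] (D : Set X) (hD : KontsevichYu.IsNormalCrossing n D)
    (f : X → OnePoint ℂ) (hf : KontsevichYu.IsHolomorphicToP1 n f)
    (hfD : ∀ y, y ∉ D → f y ≠ OnePoint.infty) :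
    ∀ (x : X) (c : KontsevichYu.NCChart n D x),
    (∀ μ : ℝ,
      c.IsFilteredQuasiIso f hf hfD 1 1
        (KontsevichYu.sigma c.S (c.mult f) (c.localF f) (c.analyticAt_localF f hf hfD) μ)
        (KontsevichYu.tau c.S (c.mult f) μ) ∧
      c.IsFilteredQuasiIso f hf hfD 0 1
        (KontsevichYu.sigma c.S (c.mult f) (c.localF f) (c.analyticAt_localF f hf hfD) μ)
        (KontsevichYu.tau c.S (c.mult f) μ)) ∧
    (∀ α : ℝ, 0 ≤ α → α < 1 →
      c.IsFilteredQuasiIso f hf hfD 1 1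
        (KontsevichYu.sigma c.S (c.mult f) (c.localF f) (c.analyticAt_localF f hf hfD) α)
        (KontsevichYu.truncatedFYu c.S (c.mult f) α) ∧
      c.IsFilteredQuasiIso f hf hfD 1 1
        (KontsevichYu.truncatedFYu c.S (c.mult f) α)
        (KontsevichYu.irregularHodge c.S (c.mult f) α) ∧
      KontsevichYu.IsSubcomplex (M := fun k => KontsevichYu.HolForms c.S k)
        (c.diff f hf hfD 1 1) (KontsevichYu.meroForms c.S) ∧
      ∀ p k, KontsevichYu.irregularHodge c.S (c.mult f) α p k ≤ KontsevichYu.meroForms c.S k) :=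
  fun _ c =>
    have h₁ := mainTheorem11_general c hf hfD 1 one_ne_zero
    ⟨fun μ => ⟨h₁.1 μ, (mainTheorem11_general c hf hfD 0 one_ne_zero).1 μ⟩, h₁.2⟩
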